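/- Call an arithmetic function $f$ multiplicative if $f(1)=1$ and $f(mn)=f(m)f(n)$ whenever $m,n\ge 1$ are coprime. Let $g$ be a non-negative real-valued multiplicative function that is uniformly bounded on the primes. Assume that the series $\sum q^{-1}g(q)$, taken over the prime powers $q=p^k$ with $k\ge 2$, converges, and that the sums $y^{-1}\sum_{q\le y} g(q)\log q$, $y\ge 2$, where $q$ runs over all prime powers $p^k$ with $k\ge 1$, are uniformly bounded. Let $h$ be a complex-valued multiplicative function with $|h(n)|\le g(n)$ for all $n\ge 1$. For real $x\ge 1$ set \[ G(x)=\sum_{n\le x}\frac{g(n)}{n},\qquad H(x)=\sum_{n\le x}\frac{h(n)}{n}. \] Then for every prime $p$ the series $\sum_{k\ge1}g(p^k)p^{-k}$ and $\sum_{k\ge1}h(p^k)p^{-k}$ converge absolutely, and \[ H(x)=\left(\prod_{p\le x}\left(1+\frac{h(p)}{p}+\frac{h(p^2)}{p^2}+\cdots\right)\left(1+\frac{g(p)}{p}+\frac{g(p^2)}{p^2}+\cdots\right)^{-1}+o(1)\right)G(x) \] as $x\to\infty$. -/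

import Mathlib

open Filter Topology

/-- The logarithmic sum `∑_{n ≤ x} f(n) / n` over positive integers `n`, for real `x`. -/
noncomputable def logSum {𝕜 : Type*} [RCLike 𝕜] (f : ArithmeticFunction 𝕜) (x : ℝ) : 𝕜 :=
  ∑ n ∈ Finset.Icc 1 ⌊x⌋₊, f n / (n : 𝕜)

/-- The local Euler factor `1 + f(p)/p + f(p²)/p² + ⋯` of `f` at `p`. -/
noncomputable def eulerFactor {𝕜 : Type*} [RCLike 𝕜] (f : ArithmeticFunction 𝕜) (p : ℕ) : 𝕜 :=
  1 + ∑' k : ℕ, f (p ^ (k + 1)) / (p : 𝕜) ^ (k + 1)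

/-!
Write `L = log x`, `G_σ = ∑ g(n) n ^ (-(1 + σ))` and `H_σ = ∑ h(n) n ^ (-(1 + σ))`, and let `P(x)`
be the product over `p ≤ x` of the ratios of Euler factors of `h` and `g`. The proof compares
`H(x) - P(x) G(x)` with the Dirichlet series `H_σ - P(x) G_σ` at the finitely many points
`σ = (k + 1) / L`, by Karamata's polynomial method.

*Regularity of `g`.* The Chebyshev-type bound on `∑_{q ≤ y} g(q) log q` and partial summation give
`∑ g(q) log q / q ^ (1 + σ) ≪ 1 / σ` for `0 < σ ≤ 1`, and `O(1 + log (z / y))` for the sum of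
`g(q) log q / q` over `y < q ≤ z`. Since `g(n) log n` is at most the Dirichlet convolution of `g`
with `q ↦ g(q) log q` (`sum_mul_log_le`), the series `G_σ` converges, satisfies `G_{1/L} ≪ G(x)`
(`exists_dirichletSum_le_mul_logSum`), and the terms `x < n ≤ x ^ (1 + η)` contribute only
`O((η + 1 / L) G_{1/L})` to `∑ g(n) / n` (`sum_window_le_dirichletSum`).

*Tauberian step.* Approximating the indicator of `t ≤ 1` by `exp (-t) Q(exp (-t))` with a polynomial
`Q`, at `t = log n / L`, expresses `H(x) - P(x) G(x)` through `H_σ - P(x) G_σ` at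
`σ = (k + 1) / L`, with an error that the regularity of `g` makes an arbitrarily small multiple of
`G_{1/L}` (`norm_sum_div_le_of_polynomial`).

*Euler products.* It remains to see that `H_σ / G_σ = P(x) + o(1)` when `σ = s / L` with `s` fixed
(`eventually_norm_prod_localRatio_sub_le`). All local ratios `r_p(σ)` have modulus at most `1`, so
products may be compared factor by factor. If `∑ (1 - ‖r_p(0)‖ ^ 2)` diverges, then `P(x) → 0`, and
the primes up to `x ^ (1 / T)` already make `H_σ / G_σ` small. If it converges, then
`‖r_p(σ) - 1‖ ^ 2` is at most a constant times `a_p (1 - ‖r_p(0)‖ ^ 2)` with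
`a_p = ∑_{k ≥ 1} g(p ^ k) p ^ (-k)`, so by Cauchy–Schwarz the primes between `x ^ (1 / T)` and
`x ^ T` can be ignored; smaller primes barely feel `σ`, and larger ones carry little weight.
-/

/-! ### Partial summation -/

/-- Abel's inequality: if the partial sums of `u` are at most those of the constant `K`, the same
holds after weighting with a nonnegative decreasing function. -/
lemma sum_mul_le_of_sum_le {u f : ℕ → ℝ} {K : ℝ}
    (hf : ∀ n, 1 ≤ n → f (n + 1) ≤ f n) (hf0 : ∀ n, 0 ≤ f n)
    (hU : ∀ N : ℕ, ∑ n ∈ Finset.Icc 1 N, u n ≤ K * N) (N : ℕ) :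
    ∑ n ∈ Finset.Icc 1 N, u n * f n ≤ K * ∑ n ∈ Finset.Icc 1 N, f n := by
  have key : ∀ N : ℕ, (K * (N + 1 : ℕ) - ∑ n ∈ Finset.Icc 1 (N + 1), u n) * f (N + 1) ≤
      K * ∑ n ∈ Finset.Icc 1 (N + 1), f n - ∑ n ∈ Finset.Icc 1 (N + 1), u n * f n := by
    intro N
    induction N with
    | zero => simp; linarith
    | succ N ih =>
      rw [Finset.sum_Icc_succ_top (by omega), Finset.sum_Icc_succ_top (b := N + 1) (by omega),
        Finset.sum_Icc_succ_top (b := N + 1) (f := fun n => u n * f n) (by omega)]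
      have h1 := mul_le_mul_of_nonneg_left (hf (N + 1) (by omega)) (sub_nonneg.2 (hU (N + 1)))
      push_cast at h1 ih ⊢
      linarith
  rcases N with _ | N
  · simp
  · have h1 := mul_nonneg (sub_nonneg.2 (hU (N + 1))) (hf0 (N + 1))
    linarith [key N]

lemma inv_succ_le_log_sub_log {n : ℕ} (hn : 1 ≤ n) :
    1 / ((n : ℝ) + 1) ≤ Real.log (n + 1) - Real.log n := by
  have h0 : (0 : ℝ) < n := by exact_mod_cast hn
  have h1 := Real.one_sub_inv_le_log_of_pos (x := ((n : ℝ) + 1) / n) (by positivity)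
  rw [Real.log_div (by positivity) (by positivity)] at h1
  refine le_trans (le_of_eq ?_) h1
  field_simp
  ring

lemma sum_inv_max_le {y z : ℝ} (hy : 0 < y) (hyz : y ≤ z) {N : ℕ} (hN : (N : ℝ) ≤ z) :
    ∑ n ∈ Finset.Icc 1 N, 1 / max (n : ℝ) y ≤ 2 + Real.log (z / y) := by
  have key : ∀ N : ℕ, ∑ n ∈ Finset.Icc 1 N, 1 / max (n : ℝ) y ≤
      if (N : ℝ) ≤ y then N / y else 2 + Real.log (N / y) := by
    intro N
    induction N with
    | zero => simp [hy.le]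
    | succ N ih =>
      rw [Finset.sum_Icc_succ_top (by omega)]
      push_cast
      by_cases h1 : (N : ℝ) + 1 ≤ y
      · rw [if_pos (by linarith)] at ih
        rw [if_pos h1, max_eq_right h1, add_div]
        linarith
      · rw [if_neg h1]
        push Not at h1
        rw [max_eq_left h1.le]
        by_cases h2 : (N : ℝ) ≤ y
        · rw [if_pos h2] at ih
          have h3 : (N : ℝ) / y ≤ 1 := by rw [div_le_one hy]; exact h2
          have h4 : 1 / ((N : ℝ) + 1) ≤ 1 := by
            rw [div_le_one (by positivity)]
            linarith [(Nat.cast_nonneg N : (0 : ℝ) ≤ N)]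
          have h5 : 0 ≤ Real.log (((N : ℝ) + 1) / y) :=
            Real.log_nonneg (by rw [le_div_iff₀ hy]; linarith)
          linarith
        · rw [if_neg h2] at ih
          push Not at h2
          have hN : 1 ≤ N := by
            have : (0 : ℝ) < N := hy.trans h2
            exact_mod_cast this
          have h3 := inv_succ_le_log_sub_log hN
          have h0 : (0 : ℝ) < N := by exact_mod_cast hN
          rw [Real.log_div (by positivity) hy.ne'] at ih ⊢
          linarith
  refine (key N).trans ?_
  have h0 : 0 ≤ Real.log (z / y) := Real.log_nonneg (by rw [le_div_iff₀ hy]; linarith)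
  split_ifs with h
  · have h3 : (N : ℝ) / y ≤ 1 := by rw [div_le_one hy]; exact h
    linarith
  · push Not at h
    have : (0 : ℝ) < N := hy.trans h
    have := Real.log_le_log (div_pos this hy) (div_le_div_of_nonneg_right hN hy.le)
    linarith

lemma sum_rpow_neg_le {σ : ℝ} (hσ : 0 < σ) (N : ℕ) :
    ∑ n ∈ Finset.Icc 1 N, (n : ℝ) ^ (-(1 + σ)) ≤ 1 + 1 / σ := by
  have key : ∀ N : ℕ, ∑ n ∈ Finset.Icc 1 (N + 1), (n : ℝ) ^ (-(1 + σ)) ≤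
      1 + 1 / σ - ((N : ℝ) + 1) ^ (-σ) / σ := by
    intro N
    induction N with
    | zero => simp
    | succ N ih =>
      rw [Finset.sum_Icc_succ_top (by omega)]
      suffices h : ((N : ℝ) + 1 + 1) ^ (-(1 + σ)) * σ ≤
          ((N : ℝ) + 1) ^ (-σ) - ((N : ℝ) + 1 + 1) ^ (-σ) by
        rw [← le_div_iff₀ hσ, sub_div] at h
        push_cast
        linarith
      have h1 : (0 : ℝ) < (N : ℝ) + 1 := by positivity
      have h2 : (0 : ℝ) < (N : ℝ) + 1 + 1 := by positivity
      have h3 := inv_succ_le_log_sub_log (n := N + 1) (by omega)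
      push_cast at h3
      have e1 : ((N : ℝ) + 1) ^ (-σ) = ((N : ℝ) + 1 + 1) ^ (-σ) *
          Real.exp (σ * (Real.log ((N : ℝ) + 1 + 1) - Real.log ((N : ℝ) + 1))) := by
        rw [Real.rpow_def_of_pos h1, Real.rpow_def_of_pos h2, ← Real.exp_add]
        congr 1; ring
      have e2 : ((N : ℝ) + 1 + 1) ^ (-(1 + σ)) =
          ((N : ℝ) + 1 + 1) ^ (-σ) * (1 / ((N : ℝ) + 1 + 1)) := by
        rw [show -(1 + σ) = -σ + -1 by ring, Real.rpow_add h2, Real.rpow_neg_one, one_div]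
      have h4 := Real.add_one_le_exp
        (σ * (Real.log ((N : ℝ) + 1 + 1) - Real.log ((N : ℝ) + 1)))
      have h5 := mul_le_mul_of_nonneg_left h3 hσ.le
      have h6 : 0 ≤ ((N : ℝ) + 1 + 1) ^ (-σ) := by positivity
      rw [e1, e2]
      have h7 := mul_le_mul_of_nonneg_left
        (show 1 / ((N : ℝ) + 1 + 1) * σ ≤ Real.exp
        (σ * (Real.log ((N : ℝ) + 1 + 1) - Real.log ((N : ℝ) + 1))) - 1 by linarith) h6
      linarith
  rcases N with _ | N
  · simp; positivity
  · refine (key N).trans ?_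
    have : 0 ≤ ((N : ℝ) + 1) ^ (-σ) / σ := by positivity
    linarith

/-! ### Weights on prime powers -/

/-- The weight `n ^ (-(1 + σ))`, so that `∑ g(n) n ^ (-(1 + σ))` is the Dirichlet series of
`g(n) / n` at the real point `σ`. -/
noncomputable def dirichletWeight (σ : ℝ) (n : ℕ) : ℝ := (n : ℝ) ^ (-(1 + σ))

lemma dirichletWeight_nonneg (σ : ℝ) (n : ℕ) : 0 ≤ dirichletWeight σ n :=
  Real.rpow_nonneg (Nat.cast_nonneg n) _

lemma dirichletWeight_one (σ : ℝ) : dirichletWeight σ 1 = 1 := by simp [dirichletWeight]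

lemma dirichletWeight_mul (σ : ℝ) (m n : ℕ) :
    dirichletWeight σ (m * n) = dirichletWeight σ m * dirichletWeight σ n := by
  simp only [dirichletWeight, Nat.cast_mul]
  exact Real.mul_rpow (Nat.cast_nonneg m) (Nat.cast_nonneg n)

lemma dirichletWeight_zero (n : ℕ) : dirichletWeight 0 n = 1 / n := by
  simp [dirichletWeight, Real.rpow_neg_one]

lemma dirichletWeight_eq {σ : ℝ} {n : ℕ} (hn : 1 ≤ n) :
    dirichletWeight σ n = 1 / n * Real.exp (-(σ * Real.log n)) := by
  have h0 : (0 : ℝ) < n := by exact_mod_cast hn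
  rw [dirichletWeight, neg_add, Real.rpow_add h0, Real.rpow_neg_one, one_div,
    Real.rpow_def_of_pos h0]
  ring_nf

lemma dirichletWeight_anti {σ τ : ℝ} (h : σ ≤ τ) {n : ℕ} (hn : 1 ≤ n) :
    dirichletWeight τ n ≤ dirichletWeight σ n :=
  Real.rpow_le_rpow_of_exponent_le (by exact_mod_cast hn) (by linarith)

lemma dirichletWeight_le {σ : ℝ} (hσ : 0 ≤ σ) {n : ℕ} (hn : 1 ≤ n) :
    dirichletWeight σ n ≤ 1 / n := by
  rw [← dirichletWeight_zero]
  exact dirichletWeight_anti hσ hn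

lemma dirichletWeight_sub_le {σ τ : ℝ} {n : ℕ} (hn : 1 ≤ n) :
    dirichletWeight σ n - dirichletWeight τ n ≤
      (τ - σ) * (dirichletWeight σ n * Real.log n) := by
  rw [dirichletWeight_eq hn, dirichletWeight_eq hn]
  have h1 := Real.add_one_le_exp (-((τ - σ) * Real.log n))
  have e : Real.exp (-(τ * Real.log n)) =
      Real.exp (-(σ * Real.log n)) * Real.exp (-((τ - σ) * Real.log n)) := by
    rw [← Real.exp_add]; congr 1; ring
  have h2 : 0 ≤ 1 / (n : ℝ) * Real.exp (-(σ * Real.log n)) := by positivity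
  have h3 := mul_le_mul_of_nonneg_left h1 h2
  rw [e]
  linarith

/-- The function `q ↦ g(q) log q` supported on the prime powers. -/
noncomputable def primePowerLog (g : ℕ → ℝ) (q : ℕ) : ℝ :=
  open Classical in if IsPrimePow q then g q * Real.log q else 0

lemma primePowerLog_nonneg {g : ℕ → ℝ} (hg : ∀ n, 0 ≤ g n) (q : ℕ) : 0 ≤ primePowerLog g q := by
  unfold primePowerLog
  split_ifs
  · exact mul_nonneg (hg q) (Real.log_natCast_nonneg q)
  · exact le_rfl

lemma primePowerLog_prime (g : ℕ → ℝ) {p : ℕ} (hp : p.Prime) :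
    primePowerLog g p = g p * Real.log p := by
  rw [primePowerLog, if_pos hp.isPrimePow]

lemma exists_sum_primePowerLog_le {g : ℕ → ℝ}
    (hg_sums : ∃ K : ℝ, ∀ y : ℝ, 2 ≤ y →
      y⁻¹ * ∑ q ∈ (Finset.Icc 1 ⌊y⌋₊).filter IsPrimePow, g q * Real.log q ≤ K) :
    ∃ K : ℝ, 1 ≤ K ∧ ∀ N : ℕ, ∑ q ∈ Finset.Icc 1 N, primePowerLog g q ≤ K * N := by
  obtain ⟨K, hK⟩ := hg_sums
  refine ⟨max K 1, le_max_right _ _, fun N => ?_⟩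
  have h1 : (1 : ℝ) ≤ max K 1 := le_max_right _ _
  rcases Nat.lt_or_ge N 2 with hN | hN
  · interval_cases N
    · simp
    · simp [primePowerLog, not_isPrimePow_one]
  · have h2 : (2 : ℝ) ≤ N := by exact_mod_cast hN
    have h := hK N h2
    rw [Nat.floor_natCast, inv_mul_le_iff₀ (by linarith), Finset.sum_filter] at h
    have e : ∑ q ∈ Finset.Icc 1 N, primePowerLog g q ≤ N * K := by
      refine le_trans (le_of_eq ?_) h
      refine Finset.sum_congr rfl fun q _ => ?_
      unfold primePowerLog
      split_ifs <;> rfl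
    refine e.trans ?_
    rw [mul_comm]
    exact mul_le_mul_of_nonneg_right (le_max_left _ _) (by linarith)

section

variable {g : ℕ → ℝ} {K : ℝ}

lemma sum_primePowerLog_mul_dirichletWeight_le (hK : 1 ≤ K)
    (hU : ∀ N : ℕ, ∑ q ∈ Finset.Icc 1 N, primePowerLog g q ≤ K * N)
    {σ : ℝ} (hσ : 0 < σ) (hσ1 : σ ≤ 1) (N : ℕ) :
    ∑ q ∈ Finset.Icc 1 N, primePowerLog g q * dirichletWeight σ q ≤ 2 * K / σ := by
  have h1 := sum_mul_le_of_sum_le (u := primePowerLog g) (f := dirichletWeight σ)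
    (fun n hn => ?_) (dirichletWeight_nonneg σ) hU N
  · refine h1.trans ?_
    have h2 := sum_rpow_neg_le hσ N
    have h3 : 1 + 1 / σ ≤ 2 / σ := by
      rw [le_div_iff₀ hσ, add_mul, one_div_mul_cancel hσ.ne']; linarith
    calc _ ≤ K * (2 / σ) := mul_le_mul_of_nonneg_left (h2.trans h3) (by linarith)
      _ = _ := by ring
  · have h0 : (0 : ℝ) < n := by exact_mod_cast hn
    exact Real.rpow_le_rpow_of_nonpos h0 (by push_cast; linarith) (by linarith)

lemma sum_primePowerLog_div_window_le (hK : 1 ≤ K) (hg : ∀ n, 0 ≤ g n)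
    (hU : ∀ N : ℕ, ∑ q ∈ Finset.Icc 1 N, primePowerLog g q ≤ K * N)
    {y z : ℝ} (hy : 0 < y) (hyz : y ≤ z) (N : ℕ) :
    ∑ q ∈ (Finset.Icc 1 N).filter (fun q : ℕ => y < q ∧ (q : ℝ) ≤ z), primePowerLog g q / q ≤
      K * (2 + Real.log (z / y)) := by
  have h0 : ∀ q : ℕ, 0 ≤ primePowerLog g q * (1 / max (q : ℝ) y) := fun q =>
    mul_nonneg (primePowerLog_nonneg hg q) (by positivity)
  calc ∑ q ∈ (Finset.Icc 1 N).filter (fun q : ℕ => y < q ∧ (q : ℝ) ≤ z), primePowerLog g q / q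
      ≤ ∑ q ∈ (Finset.Icc 1 N).filter (fun q : ℕ => y < q ∧ (q : ℝ) ≤ z),
          primePowerLog g q * (1 / max (q : ℝ) y) := by
        refine Finset.sum_le_sum fun q hq => ?_
        rw [max_eq_left (Finset.mem_filter.1 hq).2.1.le, mul_one_div]
    _ ≤ ∑ q ∈ Finset.Icc 1 ⌊z⌋₊, primePowerLog g q * (1 / max (q : ℝ) y) := by
        refine Finset.sum_le_sum_of_subset_of_nonneg (fun q hq => ?_) fun q _ _ => h0 q
        rw [Finset.mem_filter, Finset.mem_Icc] at hq
        exact Finset.mem_Icc.2 ⟨hq.1.1, Nat.le_floor hq.2.2⟩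
    _ ≤ K * ∑ q ∈ Finset.Icc 1 ⌊z⌋₊, 1 / max (q : ℝ) y :=
        sum_mul_le_of_sum_le (fun n _ => by
          apply one_div_le_one_div_of_le (by positivity)
          exact max_le_max (by push_cast; linarith) le_rfl) (fun n => by positivity) hU _
    _ ≤ _ := mul_le_mul_of_nonneg_left
        (sum_inv_max_le hy hyz (Nat.floor_le (hy.le.trans hyz))) (by linarith)

end

/-! ### Comparing `g(n) log n` with a convolution -/

/-- Splitting `log n` over the prime powers exactly dividing `n`, and dropping the coprimality
condition, bounds `g(n) log n` by a Dirichlet convolution. -/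
lemma mul_log_le_sum_divisorsAntidiagonal {g : ArithmeticFunction ℝ} (hg : g.IsMultiplicative)
    (h0 : ∀ n, 0 ≤ g n) {n : ℕ} (hn : n ≠ 0) :
    g n * Real.log n ≤ ∑ x ∈ n.divisorsAntidiagonal, g x.1 * primePowerLog g x.2 := by
  have e : g n * Real.log n = ∑ p ∈ n.primeFactors,
      g (n / p ^ n.factorization p) * primePowerLog g (p ^ n.factorization p) := by
    rw [Real.log_nat_eq_sum_factorization, Finsupp.sum, Nat.support_factorization,
      Finset.mul_sum]
    refine Finset.sum_congr rfl fun p hp => ?_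
    have hpp := Nat.prime_of_mem_primeFactors hp
    have hv : n.factorization p ≠ 0 :=
      (hpp.factorization_pos_of_dvd hn (Nat.dvd_of_mem_primeFactors hp)).ne'
    have hcop := Nat.coprime_ordCompl hpp hn
    have h1 : g n = g (p ^ n.factorization p) * g (n / p ^ n.factorization p) := by
      rw [← hg.map_mul_of_coprime (Nat.Coprime.pow_left _ hcop), Nat.ordProj_mul_ordCompl_eq_self]
    rw [primePowerLog, if_pos (hpp.isPrimePow.pow hv), h1, Nat.cast_pow, Real.log_pow]
    ring
  rw [e]
  have hinj : Set.InjOn (fun p => (n / p ^ n.factorization p, p ^ n.factorization p))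
      (n.primeFactors : Set ℕ) := by
    intro p hp q hq hpq
    have hp' := Finset.mem_coe.1 hp
    have hq' := Finset.mem_coe.1 hq
    have hpp := Nat.prime_of_mem_primeFactors hp'
    have hqq := Nat.prime_of_mem_primeFactors hq'
    have hv : n.factorization p ≠ 0 :=
      (hpp.factorization_pos_of_dvd hn (Nat.dvd_of_mem_primeFactors hp')).ne'
    have h2 : p ^ n.factorization p = q ^ n.factorization q := (Prod.ext_iff.1 hpq).2
    have h3 : p ∣ q ^ n.factorization q := h2 ▸ dvd_pow_self p hv
    exact (Nat.prime_dvd_prime_iff_eq hpp hqq).1 (hpp.dvd_of_dvd_pow h3)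
  rw [← Finset.sum_image (f := fun x : ℕ × ℕ => g x.1 * primePowerLog g x.2) hinj]
  refine Finset.sum_le_sum_of_subset_of_nonneg (fun x hx => ?_)
    fun x _ _ => mul_nonneg (h0 _) (primePowerLog_nonneg h0 _)
  obtain ⟨p, -, rfl⟩ := Finset.mem_image.1 hx
  rw [Nat.mem_divisorsAntidiagonal]
  exact ⟨Nat.div_mul_cancel (Nat.ordProj_dvd n p), hn⟩

lemma sum_mul_log_le {g : ArithmeticFunction ℝ} (hg : g.IsMultiplicative)
    (h0 : ∀ n, 0 ≤ g n) {φ : ℕ → ℝ} (hφ : ∀ n, 0 ≤ φ n) (N : ℕ) :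
    ∑ n ∈ Finset.Icc 1 N, g n * Real.log n * φ n ≤
      ∑ m ∈ Finset.Icc 1 N, g m * ∑ q ∈ Finset.Icc 1 N, primePowerLog g q * φ (m * q) := by
  have hnn : ∀ x : ℕ × ℕ, 0 ≤ g x.1 * primePowerLog g x.2 * φ (x.1 * x.2) := fun x =>
    mul_nonneg (mul_nonneg (h0 _) (primePowerLog_nonneg h0 _)) (hφ _)
  calc ∑ n ∈ Finset.Icc 1 N, g n * Real.log n * φ n
      ≤ ∑ n ∈ Finset.Icc 1 N, ∑ x ∈ (Finset.Icc 1 N ×ˢ Finset.Icc 1 N).filter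
          (fun x => x.1 * x.2 = n), g x.1 * primePowerLog g x.2 * φ (x.1 * x.2) := by
        refine Finset.sum_le_sum fun n hn => ?_
        rw [Finset.mem_Icc] at hn
        refine (mul_le_mul_of_nonneg_right (mul_log_le_sum_divisorsAntidiagonal hg h0
          (by omega)) (hφ n)).trans ?_
        rw [Finset.sum_mul]
        have : ∀ x ∈ n.divisorsAntidiagonal, g x.1 * primePowerLog g x.2 * φ n =
            g x.1 * primePowerLog g x.2 * φ (x.1 * x.2) := fun x hx => by
          rw [(Nat.mem_divisorsAntidiagonal.1 hx).1]
        rw [Finset.sum_congr rfl this]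
        refine Finset.sum_le_sum_of_subset_of_nonneg (fun x hx => ?_) fun x _ _ => hnn x
        rw [Nat.mem_divisorsAntidiagonal] at hx
        have h1 : x.1 ≠ 0 := fun h => hx.2 (by rw [← hx.1, h, zero_mul])
        have h2 : x.2 ≠ 0 := fun h => hx.2 (by rw [← hx.1, h, mul_zero])
        have h3 : x.1 ≤ n := Nat.le_of_dvd (by omega) (hx.1 ▸ dvd_mul_right _ _)
        have h4 : x.2 ≤ n := Nat.le_of_dvd (by omega) (hx.1 ▸ dvd_mul_left _ _)
        simp only [Finset.mem_filter, Finset.mem_product, Finset.mem_Icc]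
        exact ⟨⟨⟨by omega, by omega⟩, by omega, by omega⟩, hx.1⟩
    _ ≤ ∑ x ∈ Finset.Icc 1 N ×ˢ Finset.Icc 1 N,
          g x.1 * primePowerLog g x.2 * φ (x.1 * x.2) :=
        Finset.sum_fiberwise_le_sum_of_sum_fiber_nonneg
          fun n _ => Finset.sum_nonneg fun x _ => hnn x
    _ = _ := by
        rw [Finset.sum_product]
        refine Finset.sum_congr rfl fun m _ => ?_
        rw [Finset.mul_sum]
        exact Finset.sum_congr rfl fun q _ => by ring

/-! ### The Dirichlet series of `g(n) / n` near `0` -/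

/-- The Dirichlet series `∑ g(n) n ^ (-(1 + σ))`. -/
noncomputable def dirichletSum (g : ℕ → ℝ) (σ : ℝ) : ℝ := ∑' n, g n * dirichletWeight σ n

lemma sum_range_le_sum_Icc {f : ℕ → ℝ} (hf : ∀ n, 0 ≤ f n) (hf0 : f 0 = 0) (N : ℕ) :
    ∑ n ∈ Finset.range N, f n ≤ ∑ n ∈ Finset.Icc 1 N, f n := by
  have : ∑ n ∈ Finset.range N, f n ≤ ∑ n ∈ insert 0 (Finset.Icc 1 N), f n := by
    refine Finset.sum_le_sum_of_subset_of_nonneg (fun n hn => ?_) fun n _ _ => hf n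
    rw [Finset.mem_range] at hn
    rw [Finset.mem_insert, Finset.mem_Icc]
    omega
  rwa [Finset.sum_insert (by simp), hf0, zero_add] at this

section

variable {g : ArithmeticFunction ℝ} {K : ℝ}

lemma mul_dirichletWeight_nonneg (h0 : ∀ n, 0 ≤ g n) (σ : ℝ) (n : ℕ) :
    0 ≤ g n * dirichletWeight σ n := mul_nonneg (h0 n) (dirichletWeight_nonneg σ n)

lemma sum_mul_log_dirichletWeight_le (hg : g.IsMultiplicative) (h0 : ∀ n, 0 ≤ g n) (hK : 1 ≤ K)
    (hU : ∀ N : ℕ, ∑ q ∈ Finset.Icc 1 N, primePowerLog g q ≤ K * N)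
    {σ : ℝ} (hσ : 0 < σ) (hσ1 : σ ≤ 1) (N : ℕ) :
    ∑ n ∈ Finset.Icc 1 N, g n * Real.log n * dirichletWeight σ n ≤
      2 * K / σ * ∑ n ∈ Finset.Icc 1 N, g n * dirichletWeight σ n := by
  refine (sum_mul_log_le hg h0 (dirichletWeight_nonneg σ) N).trans ?_
  rw [Finset.mul_sum]
  refine Finset.sum_le_sum fun m _ => ?_
  have e : ∑ q ∈ Finset.Icc 1 N, primePowerLog g q * dirichletWeight σ (m * q) =
      dirichletWeight σ m * ∑ q ∈ Finset.Icc 1 N, primePowerLog g q * dirichletWeight σ q := by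
    rw [Finset.mul_sum]
    exact Finset.sum_congr rfl fun q _ => by rw [dirichletWeight_mul]; ring
  have h := mul_le_mul_of_nonneg_left
    (sum_primePowerLog_mul_dirichletWeight_le hK hU hσ hσ1 N) (mul_dirichletWeight_nonneg h0 σ m)
  rw [e]
  linarith

/-- The weighted mean of `log n` is at most `2K / σ`, so by Markov's inequality half of the mass
of the Dirichlet series sits on `n ≤ exp (4K / σ)`. -/
lemma sum_mul_dirichletWeight_le_logSum (hg : g.IsMultiplicative) (h0 : ∀ n, 0 ≤ g n)
    (hK : 1 ≤ K) (hU : ∀ N : ℕ, ∑ q ∈ Finset.Icc 1 N, primePowerLog g q ≤ K * N)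
    {σ : ℝ} (hσ : 0 < σ) (hσ1 : σ ≤ 1) (N : ℕ) :
    ∑ n ∈ Finset.Icc 1 N, g n * dirichletWeight σ n ≤ 2 * logSum g (Real.exp (4 * K / σ)) := by
  have h1 := sum_mul_log_dirichletWeight_le hg h0 hK hU hσ hσ1 N
  have hc : 0 < 4 * K / σ := by positivity
  have h2 : ∀ n ∈ Finset.Icc 1 N, g n * dirichletWeight σ n ≤
      (if n ≤ ⌊Real.exp (4 * K / σ)⌋₊ then g n * dirichletWeight σ n else 0) +
        (4 * K / σ)⁻¹ * (g n * Real.log n * dirichletWeight σ n) := by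
    intro n hn
    rw [Finset.mem_Icc] at hn
    have hn0 : (0 : ℝ) < n := by exact_mod_cast hn.1
    have h3 := mul_dirichletWeight_nonneg h0 σ n
    split_ifs with hle
    · have : 0 ≤ (4 * K / σ)⁻¹ * (g n * Real.log n * dirichletWeight σ n) :=
        mul_nonneg (by positivity) (mul_nonneg (mul_nonneg (h0 n) (Real.log_natCast_nonneg n))
          (dirichletWeight_nonneg σ n))
      linarith
    · rw [not_le, Nat.floor_lt (Real.exp_pos _).le] at hle
      have h4 : 4 * K / σ ≤ Real.log n := by
        rw [Real.le_log_iff_exp_le hn0]; exact hle.le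
      rw [zero_add, ← div_eq_inv_mul, le_div_iff₀ hc]
      have := mul_le_mul_of_nonneg_left h4 h3
      linarith
  have h5 := Finset.sum_le_sum h2
  rw [Finset.sum_add_distrib, ← Finset.mul_sum] at h5
  have h6 : ∑ n ∈ Finset.Icc 1 N,
      (if n ≤ ⌊Real.exp (4 * K / σ)⌋₊ then g n * dirichletWeight σ n else 0) ≤
      logSum g (Real.exp (4 * K / σ)) := by
    rw [← Finset.sum_filter, logSum]
    calc _ ≤ ∑ n ∈ Finset.Icc 1 ⌊Real.exp (4 * K / σ)⌋₊, g n * dirichletWeight σ n := by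
          refine Finset.sum_le_sum_of_subset_of_nonneg (fun n hn => ?_)
            fun n _ _ => mul_dirichletWeight_nonneg h0 σ n
          rw [Finset.mem_filter, Finset.mem_Icc] at hn
          exact Finset.mem_Icc.2 ⟨hn.1.1, hn.2⟩
      _ ≤ _ := by
          refine Finset.sum_le_sum fun n hn => ?_
          rw [div_eq_mul_one_div]
          exact mul_le_mul_of_nonneg_left
            (dirichletWeight_le hσ.le (Finset.mem_Icc.1 hn).1) (h0 n)
  have h7 := mul_le_mul_of_nonneg_left h1 (inv_nonneg.2 hc.le)
  have h8 : (4 * K / σ)⁻¹ * (2 * K / σ * ∑ n ∈ Finset.Icc 1 N, g n * dirichletWeight σ n) =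
      1 / 2 * ∑ n ∈ Finset.Icc 1 N, g n * dirichletWeight σ n := by
    rw [← mul_assoc]
    congr 1
    field_simp
    norm_num
  linarith

lemma summable_mul_dirichletWeight (hg : g.IsMultiplicative) (h0 : ∀ n, 0 ≤ g n)
    (hK : 1 ≤ K) (hU : ∀ N : ℕ, ∑ q ∈ Finset.Icc 1 N, primePowerLog g q ≤ K * N)
    {σ : ℝ} (hσ : 0 < σ) (hσ1 : σ ≤ 1) : Summable fun n => g n * dirichletWeight σ n :=
  summable_of_sum_range_le (mul_dirichletWeight_nonneg h0 σ) fun N =>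
    (sum_range_le_sum_Icc (mul_dirichletWeight_nonneg h0 σ) (by simp) N).trans
      (sum_mul_dirichletWeight_le_logSum hg h0 hK hU hσ hσ1 N)

lemma dirichletSum_le_logSum (hg : g.IsMultiplicative) (h0 : ∀ n, 0 ≤ g n)
    (hK : 1 ≤ K) (hU : ∀ N : ℕ, ∑ q ∈ Finset.Icc 1 N, primePowerLog g q ≤ K * N)
    {σ : ℝ} (hσ : 0 < σ) (hσ1 : σ ≤ 1) :
    dirichletSum g σ ≤ 2 * logSum g (Real.exp (4 * K / σ)) :=
  Real.tsum_le_of_sum_range_le (mul_dirichletWeight_nonneg h0 σ) fun N =>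
    (sum_range_le_sum_Icc (mul_dirichletWeight_nonneg h0 σ) (by simp) N).trans
      (sum_mul_dirichletWeight_le_logSum hg h0 hK hU hσ hσ1 N)

/-- The logarithmic derivative of the Dirichlet series at `σ` is at most `2K / σ`, so moving from
`σ` to `(1 + 1 / (4K)) σ` costs a factor of at most `2`. -/
lemma dirichletSum_le_two_mul (hg : g.IsMultiplicative) (h0 : ∀ n, 0 ≤ g n)
    (hK : 1 ≤ K) (hU : ∀ N : ℕ, ∑ q ∈ Finset.Icc 1 N, primePowerLog g q ≤ K * N)
    {σ : ℝ} (hσ : 0 < σ) (hσ1 : (1 + 1 / (4 * K)) * σ ≤ 1) :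
    dirichletSum g σ ≤ 2 * dirichletSum g ((1 + 1 / (4 * K)) * σ) := by
  have hr : σ ≤ (1 + 1 / (4 * K)) * σ := by
    have : 0 ≤ 1 / (4 * K) * σ := by positivity
    linarith
  refine Real.tsum_le_of_sum_range_le (mul_dirichletWeight_nonneg h0 σ) fun N =>
    (sum_range_le_sum_Icc (mul_dirichletWeight_nonneg h0 σ) (by simp) N).trans ?_
  have h1 := sum_mul_log_dirichletWeight_le hg h0 hK hU hσ (hr.trans hσ1) N
  have h2 : ∑ n ∈ Finset.Icc 1 N, g n * dirichletWeight ((1 + 1 / (4 * K)) * σ) n ≤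
      dirichletSum g ((1 + 1 / (4 * K)) * σ) :=
    (summable_mul_dirichletWeight hg h0 hK hU (hσ.trans_le hr) hσ1).sum_le_tsum _
      fun n _ => mul_dirichletWeight_nonneg h0 _ n
  have h3 : ∑ n ∈ Finset.Icc 1 N, g n * dirichletWeight σ n ≤
      ∑ n ∈ Finset.Icc 1 N, g n * dirichletWeight ((1 + 1 / (4 * K)) * σ) n +
        1 / (4 * K) * σ * ∑ n ∈ Finset.Icc 1 N, g n * Real.log n * dirichletWeight σ n := by
    rw [Finset.mul_sum, ← Finset.sum_add_distrib]
    refine Finset.sum_le_sum fun n hn => ?_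
    have h4 := mul_le_mul_of_nonneg_left (dirichletWeight_sub_le (σ := σ)
      (τ := (1 + 1 / (4 * K)) * σ) (Finset.mem_Icc.1 hn).1) (h0 n)
    linarith
  have h5 := mul_le_mul_of_nonneg_left h1 (show 0 ≤ 1 / (4 * K) * σ by positivity)
  have h6 : 1 / (4 * K) * σ * (2 * K / σ * ∑ n ∈ Finset.Icc 1 N, g n * dirichletWeight σ n) =
      1 / 2 * ∑ n ∈ Finset.Icc 1 N, g n * dirichletWeight σ n := by
    rw [← mul_assoc]
    congr 1
    field_simp
    norm_num
  linarith

lemma logSum_mono (h0 : ∀ n, 0 ≤ g n) {x y : ℝ} (h : x ≤ y) : logSum g x ≤ logSum g y := by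
  refine Finset.sum_le_sum_of_subset_of_nonneg (fun n hn => ?_)
    fun n _ _ => div_nonneg (h0 n) (Nat.cast_nonneg n)
  rw [Finset.mem_Icc] at hn ⊢
  exact ⟨hn.1, hn.2.trans (Nat.floor_mono h)⟩

lemma exists_dirichletSum_le_mul_logSum (hg : g.IsMultiplicative) (h0 : ∀ n, 0 ≤ g n)
    (hK : 1 ≤ K) (hU : ∀ N : ℕ, ∑ q ∈ Finset.Icc 1 N, primePowerLog g q ≤ K * N) :
    ∃ D : ℝ, 0 < D ∧ ∀ᶠ x : ℝ in atTop, dirichletSum g (1 / Real.log x) ≤ D * logSum g x := by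
  set r : ℝ := 1 + 1 / (4 * K) with hr
  have hr1 : 1 < r := by
    have : 0 < 1 / (4 * K) := by positivity
    linarith
  obtain ⟨j, hj⟩ := pow_unbounded_of_one_lt (4 * K) hr1
  have iter : ∀ (i : ℕ) (σ : ℝ), 0 < σ → r ^ i * σ ≤ 1 →
      dirichletSum g σ ≤ 2 ^ i * dirichletSum g (r ^ i * σ) := by
    intro i
    induction i with
    | zero => intro σ _ _; simp
    | succ i ih =>
      intro σ hσ hi
      have h1 : r ^ i * σ ≤ r ^ (i + 1) * σ :=
        mul_le_mul_of_nonneg_right (pow_le_pow_right₀ hr1.le (by omega)) hσ.le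
      have e : r ^ (i + 1) * σ = r * (r ^ i * σ) := by ring
      have h2 := ih σ hσ (h1.trans hi)
      have h3 := dirichletSum_le_two_mul hg h0 hK hU (σ := r ^ i * σ) (by positivity) (e ▸ hi)
      calc _ ≤ _ := h2
        _ ≤ 2 ^ i * (2 * dirichletSum g (r * (r ^ i * σ))) :=
          mul_le_mul_of_nonneg_left h3 (by positivity)
        _ = _ := by rw [e]; ring
  refine ⟨2 ^ j * 2, by positivity, ?_⟩
  filter_upwards [Real.tendsto_log_atTop.eventually_ge_atTop (r ^ j), eventually_gt_atTop 0]
    with x hx hx0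
  have hrj : 0 < r ^ j := by positivity
  have hL : 0 < Real.log x := hrj.trans_le hx
  have h1 : r ^ j * (1 / Real.log x) ≤ 1 := by
    rw [mul_one_div, div_le_one hL]; exact hx
  have h2 := iter j (1 / Real.log x) (by positivity) h1
  have h3 := dirichletSum_le_logSum hg h0 hK hU (σ := r ^ j * (1 / Real.log x))
    (by positivity) h1
  have h4 : Real.exp (4 * K / (r ^ j * (1 / Real.log x))) ≤ x := by
    rw [← Real.le_log_iff_exp_le hx0, mul_one_div, div_div_eq_mul_div, div_le_iff₀ hrj, mul_comm]
    exact mul_le_mul_of_nonneg_left hj.le hL.le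
  calc _ ≤ _ := h2
    _ ≤ 2 ^ j * (2 * logSum g x) := mul_le_mul_of_nonneg_left
        (h3.trans (mul_le_mul_of_nonneg_left (logSum_mono h0 h4) zero_le_two)) (by positivity)
    _ = _ := by ring

/-- Slow oscillation of the logarithmic sums: the terms with `L < log n ≤ (1 + η) L` carry little
mass. -/
lemma sum_window_le_dirichletSum (hg : g.IsMultiplicative) (h0 : ∀ n, 0 ≤ g n)
    (hK : 1 ≤ K) (hU : ∀ N : ℕ, ∑ q ∈ Finset.Icc 1 N, primePowerLog g q ≤ K * N)
    {L η : ℝ} (hL : 1 ≤ L) (hη : 0 < η) (hη1 : η ≤ 1) :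
    ∑ n ∈ (Finset.Icc 1 ⌊Real.exp ((1 + η) * L)⌋₊).filter (fun n : ℕ => L < Real.log n),
      g n / n ≤ K * (2 / L + η) * Real.exp 2 * dirichletSum g (1 / L) := by
  have hL0 : 0 < L := by linarith
  set N := ⌊Real.exp ((1 + η) * L)⌋₊ with hN
  have hlog : ∀ n ∈ Finset.Icc 1 N, Real.log n ≤ (1 + η) * L := by
    intro n hn
    rw [Finset.mem_Icc] at hn
    rw [Real.log_le_iff_le_exp (by exact_mod_cast hn.1)]
    exact (Nat.le_floor_iff (Real.exp_pos _).le).1 hn.2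
  have hsum : ∑ m ∈ Finset.Icc 1 N, g m / m ≤ Real.exp 2 * dirichletSum g (1 / L) := by
    have h1 : ∑ m ∈ Finset.Icc 1 N, g m * dirichletWeight (1 / L) m ≤ dirichletSum g (1 / L) :=
      (summable_mul_dirichletWeight hg h0 hK hU (by positivity)
        (by rw [div_le_one hL0]; exact hL)).sum_le_tsum _
        fun n _ => mul_dirichletWeight_nonneg h0 _ n
    refine le_trans ?_ (mul_le_mul_of_nonneg_left h1 (Real.exp_pos 2).le)
    rw [Finset.mul_sum]
    refine Finset.sum_le_sum fun m hm => ?_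
    have h2 : (1 : ℝ) ≤ Real.exp 2 * Real.exp (-(1 / L * Real.log m)) := by
      rw [← Real.exp_add]
      refine Real.one_le_exp ?_
      have h3 : 1 / L * Real.log m ≤ 2 := by
        rw [one_div_mul_eq_div, div_le_iff₀ hL0]
        exact (hlog m hm).trans (mul_le_mul_of_nonneg_right (by linarith) hL0.le)
      linarith
    rw [dirichletWeight_eq (Finset.mem_Icc.1 hm).1]
    have h4 := mul_le_mul_of_nonneg_left h2 (div_nonneg (h0 m) (Nat.cast_nonneg (α := ℝ) m))
    calc _ = g m / m * 1 := by ring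
      _ ≤ _ := h4
      _ = _ := by ring
  let φ : ℕ → ℝ := fun n => if L < Real.log n ∧ Real.log n ≤ (1 + η) * L then 1 / (n : ℝ) else 0
  have hφ : ∀ n, 0 ≤ φ n := fun n => by
    simp only [φ]
    split_ifs
    · positivity
    · exact le_rfl
  have h1 : L * ∑ n ∈ (Finset.Icc 1 N).filter (fun n : ℕ => L < Real.log n), g n / n ≤
      ∑ n ∈ Finset.Icc 1 N, g n * Real.log n * φ n := by
    rw [Finset.mul_sum, Finset.sum_filter]
    refine Finset.sum_le_sum fun n hn => ?_
    simp only [φ]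
    by_cases h : L < Real.log n
    · rw [if_pos h, if_pos ⟨h, hlog n hn⟩]
      exact (mul_le_mul_of_nonneg_right h.le (div_nonneg (h0 n) (Nat.cast_nonneg n))).trans_eq
        (by ring)
    · rw [if_neg h, if_neg (fun h' => h h'.1), mul_zero]
  have h2 := sum_mul_log_le hg h0 hφ N
  have h3 : ∀ m ∈ Finset.Icc 1 N, ∑ q ∈ Finset.Icc 1 N, primePowerLog g q * φ (m * q) ≤
      1 / m * (K * (2 + η * L)) := by
    intro m hm
    have hm0 : (0 : ℝ) < m := by exact_mod_cast (Finset.mem_Icc.1 hm).1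
    have hw := sum_primePowerLog_div_window_le hK h0 hU (y := Real.exp L / m)
      (z := Real.exp ((1 + η) * L) / m) (by positivity)
      (div_le_div_of_nonneg_right (Real.exp_le_exp.2 (by nlinarith)) hm0.le) N
    have e : Real.exp ((1 + η) * L) / m / (Real.exp L / m) = Real.exp (η * L) := by
      rw [div_div_div_cancel_right₀ hm0.ne', ← Real.exp_sub]; congr 1; ring
    rw [e, Real.log_exp] at hw
    refine le_trans ?_ (mul_le_mul_of_nonneg_left hw (by positivity))
    rw [Finset.mul_sum, Finset.sum_filter]
    refine Finset.sum_le_sum fun q hq => ?_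
    have hq0 : (0 : ℝ) < q := by exact_mod_cast (Finset.mem_Icc.1 hq).1
    have hiff : (L < Real.log ((m * q : ℕ) : ℝ) ∧ Real.log ((m * q : ℕ) : ℝ) ≤ (1 + η) * L) ↔
        (Real.exp L / m < q ∧ (q : ℝ) ≤ Real.exp ((1 + η) * L) / m) := by
      have hmq : (0 : ℝ) < m * q := by positivity
      rw [Nat.cast_mul, Real.lt_log_iff_exp_lt hmq, Real.log_le_iff_le_exp hmq, div_lt_iff₀ hm0,
        le_div_iff₀ hm0, mul_comm (q : ℝ)]
    simp only [φ]
    rw [if_congr hiff rfl rfl]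
    split_ifs
    · rw [Nat.cast_mul]
      apply le_of_eq
      field_simp
    · simp
  have h4 : ∑ m ∈ Finset.Icc 1 N, g m * ∑ q ∈ Finset.Icc 1 N, primePowerLog g q * φ (m * q) ≤
      K * (2 + η * L) * (Real.exp 2 * dirichletSum g (1 / L)) := by
    refine le_trans ?_ (mul_le_mul_of_nonneg_left hsum (by positivity))
    rw [Finset.mul_sum]
    refine Finset.sum_le_sum fun m hm => ?_
    exact (mul_le_mul_of_nonneg_left (h3 m hm) (h0 m)).trans_eq (by ring)
  have h5 := (h1.trans h2).trans h4
  rw [mul_comm, ← le_div_iff₀ hL0] at h5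
  refine h5.trans_eq ?_
  field_simp

end

/-! ### Karamata's polynomial method -/

/-- The cut-off `t ≤ 1` is approximated by `exp (-t) Q(exp (-t))` with `Q` a polynomial, except on
a short window to the right of `1`. -/
lemma exists_polynomial_approx_indicator {ε η : ℝ} (hε : 0 < ε) (hη : 0 < η) :
    ∃ Q : Polynomial ℝ, ∀ t : ℝ, 0 ≤ t →
      |(if t ≤ 1 then 1 else 0) - Real.exp (-t) * Q.eval (Real.exp (-t))| ≤
        ε * Real.exp (-t) + if 1 < t ∧ t ≤ 1 + η then 1 else 0 := by
  set a := Real.exp (-(1 + η)) with ha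
  set b := Real.exp (-1) with hb
  have hab : a < b := Real.exp_lt_exp.2 (by linarith)
  have hb0 : 0 < b := Real.exp_pos _
  let θ : ℝ → ℝ := fun v => max 0 (min 1 ((v - a) / (b - a))) * (max v b)⁻¹
  have hθ : Continuous θ := by
    refine Continuous.mul (by fun_prop) (Continuous.inv₀ (by fun_prop) fun v => ?_)
    exact (lt_max_of_lt_right hb0).ne'
  obtain ⟨Q, hQ⟩ := exists_polynomial_near_of_continuousOn 0 1 θ hθ.continuousOn ε hε
  refine ⟨Q, fun t ht => ?_⟩
  have hv0 : 0 < Real.exp (-t) := Real.exp_pos _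
  have h1 := hQ (Real.exp (-t)) ⟨hv0.le, Real.exp_le_one_iff.2 (by linarith)⟩
  have h2 : |(if t ≤ 1 then 1 else 0) - Real.exp (-t) * θ (Real.exp (-t))| ≤
      if 1 < t ∧ t ≤ 1 + η then 1 else 0 := by
    by_cases ht1 : t ≤ 1
    · have hvb : b ≤ Real.exp (-t) := Real.exp_le_exp.2 (by linarith)
      have h3 : θ (Real.exp (-t)) = (Real.exp (-t))⁻¹ := by
        have h4 : 1 ≤ (Real.exp (-t) - a) / (b - a) := by
          rw [le_div_iff₀ (by linarith)]; linarith
        simp only [θ]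
        rw [min_eq_left h4, max_eq_right zero_le_one, max_eq_left hvb, one_mul]
      rw [if_pos ht1, h3, mul_inv_cancel₀ hv0.ne', sub_self, abs_zero]
      split_ifs <;> norm_num
    · rw [if_neg ht1, zero_sub, abs_neg]
      push Not at ht1
      have hvb : Real.exp (-t) ≤ b := Real.exp_le_exp.2 (by linarith)
      by_cases ht2 : t ≤ 1 + η
      · rw [if_pos ⟨ht1, ht2⟩]
        simp only [θ]
        rw [max_eq_right hvb, abs_mul, abs_mul, abs_of_pos hv0, abs_of_pos (inv_pos.2 hb0),
          abs_of_nonneg (le_max_left _ _)]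
        have h3 : max 0 (min 1 ((Real.exp (-t) - a) / (b - a))) ≤ 1 :=
          max_le zero_le_one (min_le_left _ _)
        have h4 : max 0 (min 1 ((Real.exp (-t) - a) / (b - a))) * b⁻¹ ≤ b⁻¹ :=
          mul_le_of_le_one_left (inv_nonneg.2 hb0.le) h3
        calc _ ≤ Real.exp (-t) * b⁻¹ := mul_le_mul_of_nonneg_left h4 hv0.le
          _ ≤ b * b⁻¹ := mul_le_mul_of_nonneg_right hvb (inv_nonneg.2 hb0.le)
          _ = 1 := mul_inv_cancel₀ hb0.ne'
      · rw [if_neg (fun h => ht2 h.2)]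
        push Not at ht2
        have hva : Real.exp (-t) ≤ a := Real.exp_le_exp.2 (by linarith)
        have h4 : (Real.exp (-t) - a) / (b - a) ≤ 0 :=
          div_nonpos_of_nonpos_of_nonneg (by linarith) (by linarith)
        simp only [θ]
        rw [max_eq_left ((min_le_right _ _).trans h4), zero_mul, mul_zero, abs_zero]
  have h5 : Real.exp (-t) * |Q.eval (Real.exp (-t)) - θ (Real.exp (-t))| ≤
      ε * Real.exp (-t) := by
    rw [mul_comm]
    exact mul_le_mul_of_nonneg_right h1.le hv0.le
  calc |(if t ≤ 1 then 1 else 0) - Real.exp (-t) * Q.eval (Real.exp (-t))|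
      = |((if t ≤ 1 then 1 else 0) - Real.exp (-t) * θ (Real.exp (-t))) -
          Real.exp (-t) * (Q.eval (Real.exp (-t)) - θ (Real.exp (-t)))| := by
        congr 1; ring
    _ ≤ _ := abs_sub _ _
    _ ≤ _ := by
        rw [abs_mul, abs_of_pos hv0]
        linarith

/-- The effect of Karamata's approximation on a logarithmic sum: it is controlled by finitely many
values of its Dirichlet series at the points `(k + 1) / L`, up to an error measured by a
nonnegative majorant. -/
lemma norm_sum_div_le_of_polynomial {g : ℕ → ℝ} {c : ℕ → ℂ} (hg : ∀ n, 0 ≤ g n) (hg0 : g 0 = 0)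
    (hc : ∀ n, ‖c n‖ ≤ 2 * g n) {L ε η : ℝ} (hL : 0 < L) {Q : Polynomial ℝ}
    (hQ : ∀ t : ℝ, 0 ≤ t →
      |(if t ≤ 1 then 1 else 0) - Real.exp (-t) * Q.eval (Real.exp (-t))| ≤
        ε * Real.exp (-t) + if 1 < t ∧ t ≤ 1 + η then 1 else 0)
    (hs : Summable fun n => g n * dirichletWeight (1 / L) n) :
    ‖∑ n ∈ Finset.Icc 1 ⌊Real.exp L⌋₊, c n / n‖ ≤
      ∑ k ∈ Finset.range (Q.natDegree + 1),
          |Q.coeff k| * ‖∑' n, c n * (dirichletWeight ((k + 1) / L) n : ℂ)‖ +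
        2 * (ε * dirichletSum g (1 / L) +
          ∑ n ∈ (Finset.Icc 1 ⌊Real.exp ((1 + η) * L)⌋₊).filter (fun n : ℕ => L < Real.log n),
            g n / n) := by
  have hc0 : c 0 = 0 := norm_le_zero_iff.1 ((hc 0).trans (by rw [hg0, mul_zero]))
  have hsc : ∀ k : ℕ, Summable fun n => c n * (dirichletWeight ((k + 1) / L) n : ℂ) := by
    intro k
    refine Summable.of_norm_bounded (hs.mul_left 2) fun n => ?_
    rcases Nat.eq_zero_or_pos n with rfl | hn
    · simp [hc0, hg0]
    · rw [norm_mul, Complex.norm_real, Real.norm_of_nonneg (dirichletWeight_nonneg _ _),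
        ← mul_assoc]
      refine mul_le_mul (hc n) (dirichletWeight_anti ?_ hn) (dirichletWeight_nonneg _ _)
        (mul_nonneg zero_le_two (hg n))
      have : (0 : ℝ) ≤ k := Nat.cast_nonneg k
      exact div_le_div_of_nonneg_right (by linarith) hL.le
  set A := Finset.Icc 1 ⌊Real.exp L⌋₊ with hA
  set W := (Finset.Icc 1 ⌊Real.exp ((1 + η) * L)⌋₊).filter (fun n : ℕ => L < Real.log n) with hW
  have hb : HasSum (fun n => ∑ k ∈ Finset.range (Q.natDegree + 1),
      (Q.coeff k : ℂ) * (c n * (dirichletWeight ((k + 1) / L) n : ℂ)))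
      (∑ k ∈ Finset.range (Q.natDegree + 1),
        (Q.coeff k : ℂ) * ∑' n, c n * (dirichletWeight ((k + 1) / L) n : ℂ)) :=
    hasSum_sum fun k _ => (hsc k).hasSum.mul_left _
  have ha : HasSum (fun n => if n ∈ A then c n / n else 0) (∑ n ∈ A, c n / n) := by
    have := hasSum_sum_of_ne_finset_zero (L := SummationFilter.unconditional ℕ)
      (f := fun n => if n ∈ A then c n / n else 0) (s := A)
      fun n hn => if_neg hn
    rwa [Finset.sum_congr rfl fun n hn => if_pos hn] at this
  have hw : HasSum (fun n => if n ∈ W then g n / n else 0) (∑ n ∈ W, g n / n) := by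
    have := hasSum_sum_of_ne_finset_zero (L := SummationFilter.unconditional ℕ)
      (f := fun n => if n ∈ W then g n / n else 0) (s := W)
      fun n hn => if_neg hn
    rwa [Finset.sum_congr rfl fun n hn => if_pos hn] at this
  have hbound := ((hs.hasSum.mul_left ε).add hw).mul_left 2
  have hterm : ∀ n, ‖(if n ∈ A then c n / n else 0) - ∑ k ∈ Finset.range (Q.natDegree + 1),
      (Q.coeff k : ℂ) * (c n * (dirichletWeight ((k + 1) / L) n : ℂ))‖ ≤
      2 * (ε * (g n * dirichletWeight (1 / L) n) + if n ∈ W then g n / n else 0) := by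
    intro n
    rcases Nat.eq_zero_or_pos n with rfl | hn
    · simp [hc0, hg0, hA, hW]
    have hn0 : (0 : ℝ) < n := by exact_mod_cast hn
    set t := Real.log n / L with ht
    have ht0 : 0 ≤ t := div_nonneg (Real.log_natCast_nonneg n) hL.le
    have e1 : ∑ k ∈ Finset.range (Q.natDegree + 1),
        (Q.coeff k : ℂ) * (c n * (dirichletWeight ((k + 1) / L) n : ℂ)) =
        c n / n * ((Real.exp (-t) * Q.eval (Real.exp (-t)) : ℝ) : ℂ) := by
      rw [Polynomial.eval_eq_sum_range, Finset.mul_sum, Complex.ofReal_sum, Finset.mul_sum]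
      refine Finset.sum_congr rfl fun k _ => ?_
      have e2 : dirichletWeight ((k + 1) / L) n =
          1 / n * (Real.exp (-t) * Real.exp (-t) ^ k) := by
        rw [dirichletWeight_eq hn, ← pow_succ', ← Real.exp_nat_mul]
        congr 2
        rw [ht]
        push_cast
        field_simp
      rw [e2]
      push_cast
      ring
    have e3 : n ∈ A ↔ t ≤ 1 := by
      rw [hA, Finset.mem_Icc, Nat.le_floor_iff (Real.exp_pos _).le, ht, div_le_one hL,
        Real.log_le_iff_le_exp hn0]
      exact ⟨fun h => h.2, fun h => ⟨hn, h⟩⟩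
    have e4 : n ∈ W ↔ 1 < t ∧ t ≤ 1 + η := by
      rw [hW, Finset.mem_filter, Finset.mem_Icc, Nat.le_floor_iff (Real.exp_pos _).le, ht,
        one_lt_div hL, div_le_iff₀ hL, Real.log_le_iff_le_exp hn0]
      exact ⟨fun h => ⟨h.2, h.1.2⟩, fun h => ⟨⟨hn, h.2⟩, h.1⟩⟩
    have e5 : (if n ∈ A then c n / n else 0) =
        c n / n * (((if t ≤ 1 then 1 else 0 : ℝ)) : ℂ) := by
      rw [if_congr e3 rfl rfl]
      split_ifs <;> simp
    rw [e1, e5, ← mul_sub, ← Complex.ofReal_sub, norm_mul, Complex.norm_real, Real.norm_eq_abs,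
      norm_div, Complex.norm_natCast]
    calc _ ≤ 2 * g n / n *
          (ε * Real.exp (-t) + if 1 < t ∧ t ≤ 1 + η then 1 else 0) :=
          mul_le_mul (div_le_div_of_nonneg_right (hc n) hn0.le) (hQ t ht0) (abs_nonneg _)
            (div_nonneg (mul_nonneg zero_le_two (hg n)) hn0.le)
      _ = _ := by
          rw [if_congr e4 rfl rfl, dirichletWeight_eq hn, ht, one_div_mul_eq_div]
          split_ifs <;> ring_nf
  have hfin := tsum_of_norm_bounded hbound hterm
  rw [(ha.sub hb).tsum_eq] at hfin
  have hnb : ‖∑ k ∈ Finset.range (Q.natDegree + 1),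
        (Q.coeff k : ℂ) * ∑' n, c n * (dirichletWeight ((k + 1) / L) n : ℂ)‖ ≤
      ∑ k ∈ Finset.range (Q.natDegree + 1),
          |Q.coeff k| * ‖∑' n, c n * (dirichletWeight ((k + 1) / L) n : ℂ)‖ := by
    refine (norm_sum_le _ _).trans_eq (Finset.sum_congr rfl fun k _ => ?_)
    rw [norm_mul, Complex.norm_real, Real.norm_eq_abs]
  have htri := norm_le_norm_sub_add (∑ n ∈ A, c n / n) (∑ k ∈ Finset.range (Q.natDegree + 1),
        (Q.coeff k : ℂ) * ∑' n, c n * (dirichletWeight ((k + 1) / L) n : ℂ))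
  rw [dirichletSum]
  linarith

/-! ### Ratios of local factors -/

section

variable {a a' : ℝ} {b b' : ℂ}

lemma norm_ratio_le_one (hb : ‖b‖ ≤ a) : ‖(1 + b) / ((1 + a : ℝ) : ℂ)‖ ≤ 1 := by
  have ha : 0 ≤ a := (norm_nonneg b).trans hb
  rw [norm_div, Complex.norm_real, Real.norm_of_nonneg (by linarith), div_le_one (by linarith)]
  exact (norm_add_le _ _).trans (by rw [norm_one]; linarith)

lemma ratio_sub_one (ha : 0 ≤ a) :
    (1 + b) / ((1 + a : ℝ) : ℂ) - 1 = (b - a) / ((1 + a : ℝ) : ℂ) := by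
  have h : ((1 + a : ℝ) : ℂ) ≠ 0 := Complex.ofReal_ne_zero.2 (by linarith)
  rw [div_sub_one h]
  push_cast
  ring_nf

lemma norm_ratio_sub_one_le (hb : ‖b‖ ≤ a) :
    ‖(1 + b) / ((1 + a : ℝ) : ℂ) - 1‖ ≤ ‖b - a‖ := by
  have ha : 0 ≤ a := (norm_nonneg b).trans hb
  rw [ratio_sub_one ha, norm_div, Complex.norm_real, Real.norm_of_nonneg (by linarith)]
  exact div_le_self (norm_nonneg _) (by linarith)

lemma norm_ratio_sub_one_le_two_mul (hb : ‖b‖ ≤ a) :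
    ‖(1 + b) / ((1 + a : ℝ) : ℂ) - 1‖ ≤ 2 * a := by
  have ha : 0 ≤ a := (norm_nonneg b).trans hb
  refine (norm_ratio_sub_one_le hb).trans ((norm_sub_le _ _).trans ?_)
  rw [Complex.norm_real, Real.norm_of_nonneg ha]
  linarith

lemma norm_ratio_sub_ratio_le (hb' : ‖b'‖ ≤ a') (haa : ‖b - b'‖ ≤ a - a') :
    ‖(1 + b') / ((1 + a' : ℝ) : ℂ) - (1 + b) / ((1 + a : ℝ) : ℂ)‖ ≤ 2 * (a - a') := by
  have ha' : 0 ≤ a' := (norm_nonneg b').trans hb'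
  have hd : 0 ≤ a - a' := (norm_nonneg _).trans haa
  have h : ((1 + a : ℝ) : ℂ) ≠ 0 := Complex.ofReal_ne_zero.2 (by linarith)
  have h' : ((1 + a' : ℝ) : ℂ) ≠ 0 := Complex.ofReal_ne_zero.2 (by linarith)
  have e : (1 + b') / ((1 + a' : ℝ) : ℂ) - (1 + b) / ((1 + a : ℝ) : ℂ) =
      ((1 + b') / ((1 + a' : ℝ) : ℂ) * ((a - a' : ℝ) : ℂ) + -(b - b')) / ((1 + a : ℝ) : ℂ) := by
    field_simp
    push_cast
    ring
  rw [e, norm_div, Complex.norm_real, Real.norm_of_nonneg (by linarith)]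
  refine (div_le_self (norm_nonneg _) (by linarith)).trans ((norm_add_le _ _).trans ?_)
  rw [norm_mul, Complex.norm_real, Real.norm_of_nonneg hd, norm_neg]
  have := mul_le_mul_of_nonneg_right (norm_ratio_le_one hb') hd
  linarith

/-- A ratio of local factors of modulus close to `1` is itself close to `1`: the defect
`1 - ‖ratio‖ ^ 2` controls `a - Re b`, which in turn controls `‖a - b‖ ^ 2`. -/
lemma norm_ratio_sub_one_sq_le (hb : ‖b‖ ≤ a) (hb' : ‖b'‖ ≤ a') (haa : a' ≤ a)
    (hre : a' - b'.re ≤ a - b.re) :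
    ‖(1 + b') / ((1 + a' : ℝ) : ℂ) - 1‖ ^ 2 ≤
      a * (1 + a) ^ 2 * (1 - ‖(1 + b) / ((1 + a : ℝ) : ℂ)‖ ^ 2) := by
  have ha' : 0 ≤ a' := (norm_nonneg b').trans hb'
  have ha : 0 ≤ a := ha'.trans haa
  have h1 : ‖(1 + b') / ((1 + a' : ℝ) : ℂ) - 1‖ ^ 2 ≤ ‖b' - a'‖ ^ 2 :=
    pow_le_pow_left₀ (norm_nonneg _) (norm_ratio_sub_one_le hb') 2
  have hsq : ∀ z : ℂ, ‖z‖ ^ 2 = z.re ^ 2 + z.im ^ 2 := fun z => by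
    rw [Complex.sq_norm, Complex.normSq_apply]; ring
  have h2 : b'.re ^ 2 + b'.im ^ 2 ≤ a' ^ 2 := by
    rw [← hsq]; exact pow_le_pow_left₀ (norm_nonneg _) hb' 2
  have h3 : b.re ^ 2 + b.im ^ 2 ≤ a ^ 2 := by
    rw [← hsq]; exact pow_le_pow_left₀ (norm_nonneg _) hb 2
  have h4 : ‖b' - a'‖ ^ 2 ≤ 2 * a' * (a' - b'.re) := by
    rw [hsq]
    simp only [Complex.sub_re, Complex.sub_im, Complex.ofReal_re, Complex.ofReal_im]
    linarith
  have h5 : 0 ≤ a' - b'.re := by linarith [Complex.re_le_norm b']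
  have h6 : 2 * a' * (a' - b'.re) ≤ 2 * a * (a - b.re) :=
    mul_le_mul (by linarith) hre h5 (by linarith)
  have h7 : (1 + a) ^ 2 * (1 - ‖(1 + b) / ((1 + a : ℝ) : ℂ)‖ ^ 2) =
      (1 + a) ^ 2 - ((1 + b.re) ^ 2 + b.im ^ 2) := by
    have h8 : (1 + a) ^ 2 ≠ 0 := by positivity
    rw [norm_div, Complex.norm_real, Real.norm_of_nonneg (by linarith), div_pow, hsq, mul_sub,
      mul_div_cancel₀ _ h8]
    simp
  calc _ ≤ 2 * a * (a - b.re) := h1.trans (h4.trans h6)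
    _ = a * (2 * (a - b.re)) := by ring
    _ ≤ a * ((1 + a) ^ 2 - ((1 + b.re) ^ 2 + b.im ^ 2)) :=
        mul_le_mul_of_nonneg_left (by linarith) ha
    _ = _ := by rw [← h7]; ring

end

/-- The local series `∑_{k ≥ 1} f(p ^ k) p ^ (-k (1 + σ))`. -/
noncomputable def localSum {E : Type*} [NormedAddCommGroup E] [NormedSpace ℝ E]
    (f : ℕ → E) (σ : ℝ) (p : ℕ) : E :=
  ∑' k : ℕ, dirichletWeight σ (p ^ (k + 1)) • f (p ^ (k + 1))

/-- The ratio at `p` of the local factors of `h` and `g` in the Dirichlet series at `σ`. -/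
noncomputable def localRatio (h : ℕ → ℂ) (g : ℕ → ℝ) (σ : ℝ) (p : ℕ) : ℂ :=
  (1 + localSum h σ p) / ((1 + localSum g σ p : ℝ) : ℂ)

section

variable {g : ℕ → ℝ} {h : ℕ → ℂ} {p : ℕ} {σ : ℝ}

lemma summable_localSum (hg : ∀ n, 0 ≤ g n) (hp : p.Prime)
    (hs : Summable fun k : ℕ => dirichletWeight 0 (p ^ (k + 1)) • g (p ^ (k + 1))) (hσ : 0 ≤ σ) :
    Summable fun k : ℕ => dirichletWeight σ (p ^ (k + 1)) • g (p ^ (k + 1)) :=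
  Summable.of_nonneg_of_le (fun _ => mul_nonneg (dirichletWeight_nonneg _ _) (hg _))
    (fun _ => mul_le_mul_of_nonneg_right
      (dirichletWeight_anti hσ (Nat.one_le_pow _ _ hp.pos)) (hg _)) hs

lemma norm_dirichletWeight_smul_le (hh : ∀ n, ‖h n‖ ≤ g n) (n : ℕ) :
    ‖dirichletWeight σ n • h n‖ ≤ dirichletWeight σ n • g n := by
  rw [norm_smul, Real.norm_of_nonneg (dirichletWeight_nonneg _ _), smul_eq_mul]
  exact mul_le_mul_of_nonneg_left (hh n) (dirichletWeight_nonneg _ _)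

lemma summable_localSum_complex (hg : ∀ n, 0 ≤ g n) (hh : ∀ n, ‖h n‖ ≤ g n) (hp : p.Prime)
    (hs : Summable fun k : ℕ => dirichletWeight 0 (p ^ (k + 1)) • g (p ^ (k + 1))) (hσ : 0 ≤ σ) :
    Summable fun k : ℕ => dirichletWeight σ (p ^ (k + 1)) • h (p ^ (k + 1)) :=
  Summable.of_norm_bounded (summable_localSum hg hp hs hσ)
    fun _ => norm_dirichletWeight_smul_le hh _

lemma norm_localSum_le (hg : ∀ n, 0 ≤ g n) (hh : ∀ n, ‖h n‖ ≤ g n) (hp : p.Prime)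
    (hs : Summable fun k : ℕ => dirichletWeight 0 (p ^ (k + 1)) • g (p ^ (k + 1))) (hσ : 0 ≤ σ) :
    ‖localSum h σ p‖ ≤ localSum g σ p :=
  tsum_of_norm_bounded (summable_localSum hg hp hs hσ).hasSum
    fun _ => norm_dirichletWeight_smul_le hh _

lemma norm_localSum_sub_le (hg : ∀ n, 0 ≤ g n) (hh : ∀ n, ‖h n‖ ≤ g n) (hp : p.Prime)
    (hs : Summable fun k : ℕ => dirichletWeight 0 (p ^ (k + 1)) • g (p ^ (k + 1))) (hσ : 0 ≤ σ) :
    ‖localSum h 0 p - localSum h σ p‖ ≤ localSum g 0 p - localSum g σ p := by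
  have h1 := (summable_localSum_complex hg hh hp hs le_rfl).hasSum.sub
    (summable_localSum_complex hg hh hp hs hσ).hasSum
  have h2 := hs.hasSum.sub (summable_localSum hg hp hs hσ).hasSum
  rw [localSum, localSum, ← h1.tsum_eq]
  refine tsum_of_norm_bounded h2 fun k => ?_
  have h3 : 0 ≤ dirichletWeight 0 (p ^ (k + 1)) - dirichletWeight σ (p ^ (k + 1)) :=
    sub_nonneg.2 (dirichletWeight_anti hσ (Nat.one_le_pow _ _ hp.pos))
  rw [← sub_smul, ← sub_smul, norm_smul, Real.norm_of_nonneg h3]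
  exact mul_le_mul_of_nonneg_left (hh _) h3

lemma localSum_le (hg : ∀ n, 0 ≤ g n) (hp : p.Prime)
    (hs : Summable fun k : ℕ => dirichletWeight 0 (p ^ (k + 1)) • g (p ^ (k + 1))) (hσ : 0 ≤ σ) :
    localSum g σ p ≤ localSum g 0 p :=
  (summable_localSum hg hp hs hσ).tsum_le_tsum (fun _ => mul_le_mul_of_nonneg_right
      (dirichletWeight_anti hσ (Nat.one_le_pow _ _ hp.pos)) (hg _)) hs

lemma localSum_nonneg (hg : ∀ n, 0 ≤ g n) : 0 ≤ localSum g σ p :=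
  tsum_nonneg fun _ => mul_nonneg (dirichletWeight_nonneg _ _) (hg _)

lemma norm_localRatio_le_one (hg : ∀ n, 0 ≤ g n) (hh : ∀ n, ‖h n‖ ≤ g n) (hp : p.Prime)
    (hs : Summable fun k : ℕ => dirichletWeight 0 (p ^ (k + 1)) • g (p ^ (k + 1))) (hσ : 0 ≤ σ) :
    ‖localRatio h g σ p‖ ≤ 1 := norm_ratio_le_one (norm_localSum_le hg hh hp hs hσ)

lemma norm_localRatio_sub_localRatio_le (hg : ∀ n, 0 ≤ g n) (hh : ∀ n, ‖h n‖ ≤ g n)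
    (hp : p.Prime)
    (hs : Summable fun k : ℕ => dirichletWeight 0 (p ^ (k + 1)) • g (p ^ (k + 1))) (hσ : 0 ≤ σ) :
    ‖localRatio h g σ p - localRatio h g 0 p‖ ≤ 2 * (localSum g 0 p - localSum g σ p) :=
  norm_ratio_sub_ratio_le (norm_localSum_le hg hh hp hs hσ) (norm_localSum_sub_le hg hh hp hs hσ)

lemma norm_localRatio_sub_one_le (hg : ∀ n, 0 ≤ g n) (hh : ∀ n, ‖h n‖ ≤ g n) (hp : p.Prime)
    (hs : Summable fun k : ℕ => dirichletWeight 0 (p ^ (k + 1)) • g (p ^ (k + 1))) (hσ : 0 ≤ σ) :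
    ‖localRatio h g σ p - 1‖ ≤ 2 * localSum g σ p :=
  norm_ratio_sub_one_le_two_mul (norm_localSum_le hg hh hp hs hσ)

lemma norm_localRatio_sub_one_sq_le (hg : ∀ n, 0 ≤ g n) (hh : ∀ n, ‖h n‖ ≤ g n) (hp : p.Prime)
    (hs : Summable fun k : ℕ => dirichletWeight 0 (p ^ (k + 1)) • g (p ^ (k + 1))) (hσ : 0 ≤ σ) :
    ‖localRatio h g σ p - 1‖ ^ 2 ≤ localSum g 0 p * (1 + localSum g 0 p) ^ 2 *
      (1 - ‖localRatio h g 0 p‖ ^ 2) := by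
  refine norm_ratio_sub_one_sq_le (norm_localSum_le hg hh hp hs le_rfl)
    (norm_localSum_le hg hh hp hs hσ) (localSum_le hg hp hs hσ) ?_
  have h1 := norm_localSum_sub_le hg hh hp hs hσ
  have h2 := Complex.re_le_norm (localSum h 0 p - localSum h σ p)
  rw [Complex.sub_re] at h2
  linarith

end

lemma norm_prod_sub_prod_le {ι : Type*} (s : Finset ι) {u v : ι → ℂ} (hu : ∀ i ∈ s, ‖u i‖ ≤ 1)
    (hv : ∀ i ∈ s, ‖v i‖ ≤ 1) : ‖∏ i ∈ s, u i - ∏ i ∈ s, v i‖ ≤ ∑ i ∈ s, ‖u i - v i‖ := by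
  classical
  induction s using Finset.induction_on with
  | empty => simp
  | insert i s hi ih =>
    rw [Finset.prod_insert hi, Finset.prod_insert hi, Finset.sum_insert hi]
    have h1 := ih (fun j hj => hu j (Finset.mem_insert_of_mem hj))
      (fun j hj => hv j (Finset.mem_insert_of_mem hj))
    have h2 : ‖∏ j ∈ s, v j‖ ≤ 1 := by
      rw [norm_prod]
      exact Finset.prod_le_one (fun _ _ => norm_nonneg _)
        fun j hj => hv j (Finset.mem_insert_of_mem hj)
    calc ‖u i * ∏ j ∈ s, u j - v i * ∏ j ∈ s, v j‖
        = ‖u i * (∏ j ∈ s, u j - ∏ j ∈ s, v j) + (u i - v i) * ∏ j ∈ s, v j‖ := by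
          congr 1; ring
      _ ≤ ‖u i‖ * ‖∏ j ∈ s, u j - ∏ j ∈ s, v j‖ + ‖u i - v i‖ * ‖∏ j ∈ s, v j‖ := by
          refine (norm_add_le _ _).trans ?_
          rw [norm_mul, norm_mul]
      _ ≤ 1 * ∑ j ∈ s, ‖u j - v j‖ + ‖u i - v i‖ * 1 :=
          add_le_add (mul_le_mul (hu i (Finset.mem_insert_self i s)) h1 (norm_nonneg _)
            zero_le_one) (mul_le_mul_of_nonneg_left h2 (norm_nonneg _))
      _ = _ := by ring

/-! ### Sums of local series over sets of primes -/

/-- The term at `p ^ (k + 2)` of the series `∑ g(q) / q` over the proper prime powers `q`. -/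
noncomputable def higherPower (g : ℕ → ℝ) (σ : ℝ) (x : Nat.Primes × ℕ) : ℝ :=
  dirichletWeight σ ((x.1 : ℕ) ^ (x.2 + 2)) * g ((x.1 : ℕ) ^ (x.2 + 2))

lemma summable_higherPower {g : ℕ → ℝ}
    (hg_powers : Summable fun q : {q : ℕ // IsPrimePow q ∧ ¬ q.Prime} => g q / ((q : ℕ) : ℝ)) :
    Summable (higherPower g 0) := by
  let f : Nat.Primes × ℕ → {q : ℕ // IsPrimePow q ∧ ¬ q.Prime} := fun x =>
    ⟨(x.1 : ℕ) ^ (x.2 + 2), x.1.2.isPrimePow.pow (by omega), Nat.Prime.not_prime_pow (by omega)⟩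
  have hf : Function.Injective f := by
    intro x y hxy
    have h : Nat.Primes.prodNatEquiv (x.1, x.2 + 1) = Nat.Primes.prodNatEquiv (y.1, y.2 + 1) := by
      rw [Nat.Primes.prodNatEquiv_apply, Nat.Primes.prodNatEquiv_apply]
      have h0 : (x.1 : ℕ) ^ (x.2 + 2) = (y.1 : ℕ) ^ (y.2 + 2) := congrArg Subtype.val hxy
      exact Subtype.ext h0
    have h2 := Prod.ext_iff.1 (Nat.Primes.prodNatEquiv.injective h)
    exact Prod.ext h2.1 (Nat.succ_injective h2.2)
  refine (hg_powers.comp_injective hf).congr fun x => ?_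
  simp only [Function.comp, f, higherPower]
  rw [dirichletWeight_zero]
  ring

lemma sum_tsum_le_tsum_primes {F : Nat.Primes × ℕ → ℝ} {f : ℕ → ℕ → ℝ} (hF : Summable F)
    (hF0 : ∀ x, 0 ≤ F x) (hf : ∀ x, F x = f x.1 x.2) {S : Finset ℕ} (hS : ∀ p ∈ S, p.Prime) :
    ∑ p ∈ S, ∑' k, f p k ≤ ∑' x, F x := by
  rw [← Finset.sum_subtype_of_mem (fun p => ∑' k, f p k) hS, hF.tsum_prod]
  have h1 : ∀ p : Nat.Primes, ∑' k, F (p, k) = ∑' k, f p k := fun p =>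
    tsum_congr fun k => hf (p, k)
  have h3 : Summable fun p : Nat.Primes => ∑' k, F (p, k) := hF.prod
  have h2 : ∑ p ∈ S.subtype Nat.Prime, ∑' k, F (p, k) ≤ ∑' p : Nat.Primes, ∑' k, F (p, k) :=
    Summable.sum_le_tsum (L := SummationFilter.unconditional Nat.Primes) _
      (fun p _ => tsum_nonneg fun k => hF0 (p, k)) h3
  refine le_trans (le_of_eq ?_) h2
  exact Finset.sum_congr rfl fun p _ => (h1 p).symm

section

variable {g : ℕ → ℝ} {K : ℝ}

lemma higherPower_nonneg (hg : ∀ n, 0 ≤ g n) (σ : ℝ) (x : Nat.Primes × ℕ) :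
    0 ≤ higherPower g σ x := mul_nonneg (dirichletWeight_nonneg _ _) (hg _)

lemma higherPower_le (hg : ∀ n, 0 ≤ g n) {σ : ℝ} (hσ : 0 ≤ σ) (x : Nat.Primes × ℕ) :
    higherPower g σ x ≤ higherPower g 0 x :=
  mul_le_mul_of_nonneg_right (dirichletWeight_anti hσ (Nat.one_le_pow _ _ x.1.2.pos)) (hg _)

lemma summable_localSum_of_higherPower (hP : Summable (higherPower g 0)) {p : ℕ}
    (hp : p.Prime) :
    Summable fun k : ℕ => dirichletWeight 0 (p ^ (k + 1)) • g (p ^ (k + 1)) :=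
  (summable_nat_add_iff 1).1 (hP.prod_factor ⟨p, hp⟩)

lemma localSum_eq_add (hg : ∀ n, 0 ≤ g n) (hP : Summable (higherPower g 0)) {p : ℕ}
    (hp : p.Prime) {σ : ℝ} (hσ : 0 ≤ σ) :
    localSum g σ p = dirichletWeight σ p * g p +
      ∑' k : ℕ, dirichletWeight σ (p ^ (k + 2)) * g (p ^ (k + 2)) := by
  rw [localSum,
    (summable_localSum hg hp (summable_localSum_of_higherPower hP hp) hσ).tsum_eq_zero_add]
  simp

lemma tendsto_tsum_higherPower_sub (hg : ∀ n, 0 ≤ g n) (hP : Summable (higherPower g 0)) :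
    Tendsto (fun σ => ∑' x, (higherPower g 0 x - higherPower g σ x)) (𝓝[>] 0) (𝓝 0) := by
  refine (tendsto_tsum_of_dominated_convergence hP (g := fun _ => 0) (fun x => ?_) ?_).mono_right (by rw [tsum_zero])
  · have hx : ((((x.1 : ℕ) ^ (x.2 + 2) : ℕ)) : ℝ) ≠ 0 := by
      exact_mod_cast (pow_pos x.1.2.pos _).ne'
    have hc : Continuous fun σ => higherPower g 0 x - higherPower g σ x := by
      unfold higherPower dirichletWeight
      exact continuous_const.sub
        (((Real.continuous_const_rpow hx).comp (by fun_prop)).mul continuous_const)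
    have := (hc.tendsto 0).mono_left (nhdsWithin_le_nhds (s := Set.Ioi 0))
    rwa [sub_self] at this
  · filter_upwards [self_mem_nhdsWithin] with σ hσ x
    have h1 := higherPower_le hg (le_of_lt hσ) x
    have h2 := higherPower_nonneg hg σ x
    rw [Real.norm_of_nonneg (by linarith)]
    linarith

lemma tendsto_tsum_higherPower_tail (hg : ∀ n, 0 ≤ g n) (hP : Summable (higherPower g 0)) :
    Tendsto (fun Y : ℝ => ∑' x : Nat.Primes × ℕ,
      if Y < Real.log (x.1 : ℕ) then higherPower g 0 x else 0) atTop (𝓝 0) := by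
  refine (tendsto_tsum_of_dominated_convergence hP (g := fun _ => 0) (fun x => ?_)
    (Eventually.of_forall ?_)).mono_right (by rw [tsum_zero])
  · refine tendsto_const_nhds.congr' ?_
    filter_upwards [eventually_ge_atTop (Real.log (x.1 : ℕ))] with Y hY
    rw [if_neg (not_lt.2 hY)]
  · intro Y x
    split_ifs
    · rw [Real.norm_of_nonneg (higherPower_nonneg hg 0 x)]
    · rw [norm_zero]; exact higherPower_nonneg hg 0 x

lemma sum_primes_mul_log_dirichletWeight_le (hg : ∀ n, 0 ≤ g n) (hK : 1 ≤ K)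
    (hU : ∀ N : ℕ, ∑ q ∈ Finset.Icc 1 N, primePowerLog g q ≤ K * N)
    {σ : ℝ} (hσ : 0 < σ) (hσ1 : σ ≤ 1) {S : Finset ℕ} (hS : ∀ p ∈ S, p.Prime) :
    ∑ p ∈ S, dirichletWeight σ p * g p * Real.log p ≤ 2 * K / σ := by
  obtain ⟨N, hN⟩ := S.exists_nat_subset_range
  refine le_trans ?_ (sum_primePowerLog_mul_dirichletWeight_le hK hU hσ hσ1 N)
  refine le_trans (le_of_eq (Finset.sum_congr rfl fun p hp => ?_))
    (Finset.sum_le_sum_of_subset_of_nonneg (s := S) (fun p hp => ?_) fun q _ _ =>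
      mul_nonneg (primePowerLog_nonneg hg q) (dirichletWeight_nonneg σ q))
  · rw [primePowerLog_prime g (hS p hp)]; ring
  · have := Finset.mem_range.1 (hN hp)
    exact Finset.mem_Icc.2 ⟨(hS p hp).one_le, this.le⟩

/-- Chebyshev's bound for the primes up to `exp Y`, deduced from the Dirichlet series at
`1 / Y`. -/
lemma sum_primes_mul_log_le (hg : ∀ n, 0 ≤ g n) (hK : 1 ≤ K)
    (hU : ∀ N : ℕ, ∑ q ∈ Finset.Icc 1 N, primePowerLog g q ≤ K * N)
    {Y : ℝ} (hY : 1 ≤ Y) {S : Finset ℕ} (hS : ∀ p ∈ S, p.Prime)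
    (hSY : ∀ p ∈ S, Real.log p ≤ Y) :
    ∑ p ∈ S, dirichletWeight 0 p * g p * Real.log p ≤ Real.exp 1 * (2 * K) * Y := by
  have hY0 : 0 < Y := by linarith
  have h1 := sum_primes_mul_log_dirichletWeight_le hg hK hU (σ := 1 / Y) (by positivity)
    (by rw [div_le_one hY0]; exact hY) hS
  have h2 := mul_le_mul_of_nonneg_left h1 (Real.exp_pos 1).le
  have e : Real.exp 1 * (2 * K / (1 / Y)) = Real.exp 1 * (2 * K) * Y := by field_simp
  rw [e] at h2
  refine le_trans ?_ h2
  rw [Finset.mul_sum]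
  refine Finset.sum_le_sum fun p hp => ?_
  have h3 : dirichletWeight 0 p ≤ Real.exp 1 * dirichletWeight (1 / Y) p := by
    rw [dirichletWeight_zero, dirichletWeight_eq (hS p hp).one_le, mul_left_comm, ← Real.exp_add]
    refine le_mul_of_one_le_right (by positivity) (Real.one_le_exp ?_)
    rw [one_div_mul_eq_div]
    have : Real.log p / Y ≤ 1 := by rw [div_le_one hY0]; exact hSY p hp
    linarith
  have h4 := mul_le_mul_of_nonneg_right h3
    (mul_nonneg (hg p) (Real.log_natCast_nonneg p))
  linarith

lemma sum_localSum_sub_le (hg : ∀ n, 0 ≤ g n) (hP : Summable (higherPower g 0)) (hK : 1 ≤ K)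
    (hU : ∀ N : ℕ, ∑ q ∈ Finset.Icc 1 N, primePowerLog g q ≤ K * N)
    {σ Y : ℝ} (hσ : 0 ≤ σ) (hY : 1 ≤ Y) {S : Finset ℕ} (hS : ∀ p ∈ S, p.Prime)
    (hSY : ∀ p ∈ S, Real.log p ≤ Y) :
    ∑ p ∈ S, (localSum g 0 p - localSum g σ p) ≤ σ * (Real.exp 1 * (2 * K) * Y) +
      ∑' x, (higherPower g 0 x - higherPower g σ x) := by
  have hPσ : Summable (higherPower g σ) :=
    Summable.of_nonneg_of_le (higherPower_nonneg hg σ) (higherPower_le hg hσ) hP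
  have h1 := mul_le_mul_of_nonneg_left (sum_primes_mul_log_le hg hK hU hY hS hSY) hσ
  have h2 := sum_tsum_le_tsum_primes (hP.sub hPσ)
    (fun x => sub_nonneg.2 (higherPower_le hg hσ x))
    (f := fun p k => dirichletWeight 0 (p ^ (k + 2)) * g (p ^ (k + 2)) -
      dirichletWeight σ (p ^ (k + 2)) * g (p ^ (k + 2))) (fun x => rfl) hS
  refine le_trans ?_ (add_le_add h1 h2)
  rw [Finset.mul_sum, ← Finset.sum_add_distrib]
  refine Finset.sum_le_sum fun p hp => ?_
  have hp' := hS p hp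
  rw [localSum_eq_add hg hP hp' le_rfl, localSum_eq_add hg hP hp' hσ,
    show ∑' k : ℕ, (dirichletWeight 0 (p ^ (k + 2)) * g (p ^ (k + 2)) -
      dirichletWeight σ (p ^ (k + 2)) * g (p ^ (k + 2))) = _ from
      (hP.prod_factor ⟨p, hp'⟩).tsum_sub (hPσ.prod_factor ⟨p, hp'⟩)]
  have h3 := mul_le_mul_of_nonneg_right
    (dirichletWeight_sub_le (σ := 0) (τ := σ) hp'.one_le) (hg p)
  simp only [higherPower]
  linarith

lemma sum_localSum_window_le (hg : ∀ n, 0 ≤ g n) (hP : Summable (higherPower g 0)) (hK : 1 ≤ K)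
    (hU : ∀ N : ℕ, ∑ q ∈ Finset.Icc 1 N, primePowerLog g q ≤ K * N)
    {Y Z : ℝ} (hY : 0 < Y) (hZ : 1 ≤ Z) {S : Finset ℕ} (hS : ∀ p ∈ S, p.Prime)
    (hSY : ∀ p ∈ S, Y < Real.log p ∧ Real.log p ≤ Z) :
    ∑ p ∈ S, localSum g 0 p ≤ Real.exp 1 * (2 * K) * Z / Y + ∑' x, higherPower g 0 x := by
  have h1 := div_le_div_of_nonneg_right
    (sum_primes_mul_log_le hg hK hU hZ hS fun p hp => (hSY p hp).2) hY.le
  have h2 := sum_tsum_le_tsum_primes hP (higherPower_nonneg hg 0)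
    (f := fun p k => dirichletWeight 0 (p ^ (k + 2)) * g (p ^ (k + 2))) (fun x => rfl) hS
  refine le_trans ?_ (add_le_add h1 h2)
  rw [Finset.sum_div, ← Finset.sum_add_distrib]
  refine Finset.sum_le_sum fun p hp => ?_
  rw [localSum_eq_add hg hP (hS p hp) le_rfl]
  refine add_le_add ?_ le_rfl
  rw [le_div_iff₀ hY]
  exact mul_le_mul_of_nonneg_left (hSY p hp).1.le
    (mul_nonneg (dirichletWeight_nonneg _ _) (hg p))

lemma sum_localSum_tail_le (hg : ∀ n, 0 ≤ g n) (hP : Summable (higherPower g 0)) (hK : 1 ≤ K)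
    (hU : ∀ N : ℕ, ∑ q ∈ Finset.Icc 1 N, primePowerLog g q ≤ K * N)
    {σ Y : ℝ} (hσ : 0 < σ) (hσ1 : σ ≤ 1) (hY : 0 < Y) {S : Finset ℕ} (hS : ∀ p ∈ S, p.Prime)
    (hSY : ∀ p ∈ S, Y < Real.log p) :
    ∑ p ∈ S, localSum g σ p ≤ 2 * K / σ / Y + ∑' x : Nat.Primes × ℕ,
      if Y < Real.log (x.1 : ℕ) then higherPower g 0 x else 0 := by
  have hPσ : Summable (higherPower g σ) :=
    Summable.of_nonneg_of_le (higherPower_nonneg hg σ) (higherPower_le hg hσ.le) hP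
  have hi : ∀ x : Nat.Primes × ℕ,
      0 ≤ (if Y < Real.log (x.1 : ℕ) then higherPower g 0 x else 0) := fun x => by
    split_ifs
    · exact higherPower_nonneg hg 0 x
    · exact le_rfl
  have h1 := div_le_div_of_nonneg_right
    (sum_primes_mul_log_dirichletWeight_le hg hK hU hσ hσ1 hS) hY.le
  have h2 := sum_tsum_le_tsum_primes (F := fun x : Nat.Primes × ℕ =>
      if Y < Real.log (x.1 : ℕ) then higherPower g 0 x else 0)
    (Summable.of_nonneg_of_le hi (fun x => by
      split_ifs
      · exact le_rfl
      · exact higherPower_nonneg hg 0 x) hP) hi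
    (f := fun p k => if Y < Real.log p then
      dirichletWeight 0 (p ^ (k + 2)) * g (p ^ (k + 2)) else 0) (fun x => rfl) hS
  refine le_trans ?_ (add_le_add h1 h2)
  rw [Finset.sum_div, ← Finset.sum_add_distrib]
  refine Finset.sum_le_sum fun p hp => ?_
  rw [localSum_eq_add hg hP (hS p hp) hσ.le]
  refine add_le_add ?_ ?_
  · rw [le_div_iff₀ hY]
    exact mul_le_mul_of_nonneg_left (hSY p hp).le
      (mul_nonneg (dirichletWeight_nonneg _ _) (hg p))
  · simp only [if_pos (hSY p hp)]
    exact (hPσ.prod_factor ⟨p, hS p hp⟩).tsum_le_tsum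
      (fun k => higherPower_le hg hσ.le (⟨p, hS p hp⟩, k)) (hP.prod_factor ⟨p, hS p hp⟩)

end

/-! ### Truncating the Euler product -/

/-- The primes `p` with `log p ≤ Y`. -/
noncomputable def primesLogLE (Y : ℝ) : Finset ℕ :=
  (Finset.Icc 1 ⌊Real.exp Y⌋₊).filter Nat.Prime

lemma mem_primesLogLE {Y : ℝ} {p : ℕ} : p ∈ primesLogLE Y ↔ p.Prime ∧ Real.log p ≤ Y := by
  rw [primesLogLE, Finset.mem_filter, Finset.mem_Icc, Nat.le_floor_iff (Real.exp_pos Y).le]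
  constructor
  · rintro ⟨⟨h1, h2⟩, hp⟩
    exact ⟨hp, (Real.log_le_iff_le_exp (by exact_mod_cast h1)).2 h2⟩
  · rintro ⟨hp, h⟩
    exact ⟨⟨hp.one_le, (Real.log_le_iff_le_exp (by exact_mod_cast hp.pos)).1 h⟩, hp⟩

lemma eventually_filter_primesBelow (Y : ℝ) :
    ∀ᶠ N : ℕ in atTop, (Nat.primesBelow N).filter (fun p : ℕ => Real.log p ≤ Y) =
      primesLogLE Y := by
  filter_upwards [eventually_gt_atTop ⌊Real.exp Y⌋₊] with N hN
  ext p
  rw [Finset.mem_filter, Nat.mem_primesBelow, mem_primesLogLE]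
  constructor
  · rintro ⟨⟨-, hp⟩, h⟩
    exact ⟨hp, h⟩
  · intro h
    refine ⟨⟨?_, h.1⟩, h.2⟩
    have h1 := mem_primesLogLE.2 h
    rw [primesLogLE, Finset.mem_filter, Finset.mem_Icc] at h1
    omega

section

variable {g : ℕ → ℝ} {h : ℕ → ℂ} {K : ℝ}

lemma sum_norm_localRatio_sub_le (hg : ∀ n, 0 ≤ g n) (hh : ∀ n, ‖h n‖ ≤ g n)
    (hP : Summable (higherPower g 0)) (hK : 1 ≤ K)
    (hU : ∀ N : ℕ, ∑ q ∈ Finset.Icc 1 N, primePowerLog g q ≤ K * N)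
    {σ Y : ℝ} (hσ : 0 ≤ σ) (hY : 1 ≤ Y) {S : Finset ℕ} (hS : ∀ p ∈ S, p.Prime)
    (hSY : ∀ p ∈ S, Real.log p ≤ Y) :
    ∑ p ∈ S, ‖localRatio h g σ p - localRatio h g 0 p‖ ≤
      2 * (σ * (Real.exp 1 * (2 * K) * Y) +
        ∑' x, (higherPower g 0 x - higherPower g σ x)) := by
  refine le_trans ?_ (mul_le_mul_of_nonneg_left
    (sum_localSum_sub_le hg hP hK hU hσ hY hS hSY) zero_le_two)
  rw [Finset.mul_sum]
  exact Finset.sum_le_sum fun p hp => norm_localRatio_sub_localRatio_le hg hh (hS p hp)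
    (summable_localSum_of_higherPower hP (hS p hp)) hσ

/-- The defect `1 - ‖localRatio‖ ^ 2` at the primes, extended by zero to all natural numbers.
Its summability decides whether the Euler product of the ratios tends to `0`. -/
noncomputable def ratioDefect (h : ℕ → ℂ) (g : ℕ → ℝ) (n : ℕ) : ℝ :=
  if n.Prime then 1 - ‖localRatio h g 0 n‖ ^ 2 else 0

lemma ratioDefect_nonneg (hg : ∀ n, 0 ≤ g n) (hh : ∀ n, ‖h n‖ ≤ g n)
    (hP : Summable (higherPower g 0)) (n : ℕ) : 0 ≤ ratioDefect h g n := by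
  unfold ratioDefect
  split_ifs with hp
  · exact sub_nonneg.2 (pow_le_one₀ (norm_nonneg _)
      (norm_localRatio_le_one hg hh hp (summable_localSum_of_higherPower hP hp) le_rfl))
  · exact le_rfl

lemma sum_norm_localRatio_sub_one_window_le (hg : ∀ n, 0 ≤ g n) (hh : ∀ n, ‖h n‖ ≤ g n)
    (hP : Summable (higherPower g 0)) (hd : Summable (ratioDefect h g))
    {σ Y B : ℝ} (hσ : 0 ≤ σ) {S : Finset ℕ} (hS : ∀ p ∈ S, p.Prime)
    (hSY : ∀ p ∈ S, Y < Real.log p) (hB : ∑ p ∈ S, localSum g 0 p ≤ B) :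
    ∑ p ∈ S, ‖localRatio h g σ p - 1‖ ≤
      √(B * (1 + B) ^ 2 * ∑' n : ℕ, if Y < Real.log n then ratioDefect h g n else 0) := by
  have hnn : ∀ p, 0 ≤ localSum g 0 p := fun p => localSum_nonneg hg
  have hd0 := ratioDefect_nonneg hg hh hP
  have hB0 : 0 ≤ B := (Finset.sum_nonneg fun p _ => hnn p).trans hB
  have hi : ∀ n : ℕ, 0 ≤ if Y < Real.log n then ratioDefect h g n else 0 := fun n => by
    split_ifs
    · exact hd0 n
    · exact le_rfl
  have h1 : ∑ p ∈ S, ratioDefect h g p ≤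
      ∑' n : ℕ, if Y < Real.log n then ratioDefect h g n else 0 := by
    refine le_trans (le_of_eq (Finset.sum_congr rfl fun p hp => ?_))
      ((Summable.of_nonneg_of_le hi (fun n => ?_) hd).sum_le_tsum S fun n _ => hi n)
    · rw [if_pos (hSY p hp)]
    · split_ifs
      · exact le_rfl
      · exact hd0 n
  have h2 : ∑ p ∈ S, localSum g 0 p * (1 + localSum g 0 p) ^ 2 ≤ B * (1 + B) ^ 2 := by
    calc _ ≤ ∑ p ∈ S, localSum g 0 p * (1 + B) ^ 2 := by
          refine Finset.sum_le_sum fun p hp => mul_le_mul_of_nonneg_left ?_ (hnn p)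
          have h3 : localSum g 0 p ≤ B :=
            (Finset.single_le_sum (fun q _ => hnn q) hp).trans hB
          exact pow_le_pow_left₀ (by linarith [hnn p]) (by linarith) 2
      _ ≤ _ := by
          rw [← Finset.sum_mul]
          exact mul_le_mul_of_nonneg_right hB (by positivity)
  refine Real.le_sqrt_of_sq_le ?_
  refine (Finset.sum_sq_le_sum_mul_sum_of_sq_le_mul S
    (f := fun p => localSum g 0 p * (1 + localSum g 0 p) ^ 2) (g := ratioDefect h g)
    (fun p _ => mul_nonneg (hnn p) (by positivity)) (fun p _ => hd0 p)
    fun p hp => ?_).trans ?_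
  · rw [ratioDefect, if_pos (hS p hp)]
    exact norm_localRatio_sub_one_sq_le hg hh (hS p hp)
      (summable_localSum_of_higherPower hP (hS p hp)) hσ
  · exact mul_le_mul h2 h1 (Finset.sum_nonneg fun p _ => hd0 p) (by positivity)

lemma tendsto_tsum_ratioDefect_tail (hg : ∀ n, 0 ≤ g n) (hh : ∀ n, ‖h n‖ ≤ g n)
    (hP : Summable (higherPower g 0)) (hd : Summable (ratioDefect h g)) :
    Tendsto (fun Y : ℝ => ∑' n : ℕ, if Y < Real.log n then ratioDefect h g n else 0)
      atTop (𝓝 0) := by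
  refine (tendsto_tsum_of_dominated_convergence hd (g := fun _ => 0) (fun n => ?_)
    (Eventually.of_forall ?_)).mono_right (by rw [tsum_zero])
  · refine tendsto_const_nhds.congr' ?_
    filter_upwards [eventually_ge_atTop (Real.log n)] with Y hY
    rw [if_neg (not_lt.2 hY)]
  · intro Y n
    have h0 := ratioDefect_nonneg hg hh hP n
    split_ifs
    · rw [Real.norm_of_nonneg h0]
    · rwa [norm_zero]

lemma tendsto_prod_localRatio_of_not_summable (hg : ∀ n, 0 ≤ g n) (hh : ∀ n, ‖h n‖ ≤ g n)
    (hP : Summable (higherPower g 0)) (hd : ¬ Summable (ratioDefect h g)) :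
    Tendsto (fun Y : ℝ => ‖∏ p ∈ primesLogLE Y, localRatio h g 0 p‖) atTop (𝓝 0) := by
  have hd0 := ratioDefect_nonneg hg hh hP
  have h1 := (not_summable_iff_tendsto_nat_atTop_of_nonneg hd0).1 hd
  have h2 : Tendsto (fun Y : ℝ => ∑ n ∈ Finset.range (⌊Real.exp Y⌋₊ + 1), ratioDefect h g n)
      atTop atTop :=
    h1.comp ((tendsto_add_atTop_nat 1).comp
      ((tendsto_nat_floor_atTop (α := ℝ)).comp Real.tendsto_exp_atTop))
  have h3 : Tendsto (fun Y : ℝ => √(Real.exp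
      (-∑ n ∈ Finset.range (⌊Real.exp Y⌋₊ + 1), ratioDefect h g n))) atTop (𝓝 0) := by
    have := (Real.continuous_sqrt.tendsto 0).comp (Real.tendsto_exp_neg_atTop_nhds_zero.comp h2)
    rwa [Real.sqrt_zero] at this
  refine squeeze_zero (fun _ => norm_nonneg _) (fun Y => ?_) h3
  refine Real.le_sqrt_of_sq_le ?_
  have h4 : ∑ n ∈ Finset.range (⌊Real.exp Y⌋₊ + 1), ratioDefect h g n =
      ∑ p ∈ primesLogLE Y, (1 - ‖localRatio h g 0 p‖ ^ 2) := by
    have e : primesLogLE Y = (Finset.range (⌊Real.exp Y⌋₊ + 1)).filter Nat.Prime := by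
      ext p
      rw [primesLogLE, Finset.mem_filter, Finset.mem_filter, Finset.mem_Icc, Finset.mem_range]
      constructor
      · rintro ⟨h1, h2⟩
        exact ⟨by omega, h2⟩
      · rintro ⟨h1, h2⟩
        exact ⟨⟨h2.one_le, by omega⟩, h2⟩
    rw [e, Finset.sum_filter]
    rfl
  rw [h4, norm_prod, ← Finset.prod_pow, ← Finset.sum_neg_distrib, Real.exp_sum]
  refine Finset.prod_le_prod (fun p _ => by positivity) fun p _ => ?_
  have := Real.add_one_le_exp (-(1 - ‖localRatio h g 0 p‖ ^ 2))
  linarith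

/-- If the defects are summable, replacing `σ = s / L` by `0` at the primes with `log p ≤ L`, and
dropping the other primes, changes the product of the ratios by little. The primes are cut at
`L / T` and `L T`: the small ones barely feel `σ`, the large ones carry no weight, and in between
all ratios are close to `1`. -/
lemma norm_prod_localRatio_sub_le_of_summable (hg : ∀ n, 0 ≤ g n) (hh : ∀ n, ‖h n‖ ≤ g n)
    (hP : Summable (higherPower g 0)) (hK : 1 ≤ K)
    (hU : ∀ N : ℕ, ∑ q ∈ Finset.Icc 1 N, primePowerLog g q ≤ K * N)
    (hd : Summable (ratioDefect h g)) {s L T : ℝ} (hs : 0 < s) (hsL : s ≤ L) (hT : 1 ≤ T)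
    (hTL : T ≤ L) {S : Finset ℕ} (hS : ∀ p ∈ S, p.Prime) {B : ℝ}
    (hB : B = Real.exp 1 * (2 * K) * T ^ 2 + ∑' x, higherPower g 0 x) :
    ‖∏ p ∈ S, localRatio h g (s / L) p -
        ∏ p ∈ S.filter (fun p : ℕ => Real.log p ≤ L), localRatio h g 0 p‖ ≤
      2 * (s * (Real.exp 1 * (2 * K)) / T +
        ∑' x, (higherPower g 0 x - higherPower g (s / L) x)) +
      2 * √(B * (1 + B) ^ 2 *
        ∑' n : ℕ, if L / T < Real.log n then ratioDefect h g n else 0) +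
      2 * (2 * K / s / T + ∑' x : Nat.Primes × ℕ,
        if L * T < Real.log (x.1 : ℕ) then higherPower g 0 x else 0) := by
  have hT0 : 0 < T := by linarith
  have hL : 0 < L := by linarith
  have hσ : 0 < s / L := by positivity
  have hσ1 : s / L ≤ 1 := by rw [div_le_one hL]; exact hsL
  have hLT : L ≤ L * T := le_mul_of_one_le_right hL.le hT
  have hLT' : L / T ≤ L := div_le_self hL.le hT
  have hsum : ∀ p ∈ S, Summable fun k : ℕ =>
      dirichletWeight 0 (p ^ (k + 1)) • g (p ^ (k + 1)) := fun p hp =>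
    summable_localSum_of_higherPower hP (hS p hp)
  rw [Finset.prod_filter]
  refine (norm_prod_sub_prod_le S (fun p hp => norm_localRatio_le_one hg hh (hS p hp)
    (hsum p hp) hσ.le) fun p hp => ?_).trans ?_
  · split_ifs
    · exact norm_localRatio_le_one hg hh (hS p hp) (hsum p hp) le_rfl
    · rw [norm_one]
  set S₁ := S.filter (fun p : ℕ => Real.log p ≤ L / T) with hS₁
  set S₂ := S.filter (fun p : ℕ => L / T < Real.log p ∧ Real.log p ≤ L * T) with hS₂
  set S₃ := S.filter (fun p : ℕ => L * T < Real.log p) with hS₃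
  have b1 := sum_norm_localRatio_sub_le hg hh hP hK hU (S := S₁) (σ := s / L) (Y := L / T) hσ.le
    (by rw [le_div_iff₀ hT0]; linarith) (fun p hp => hS p (Finset.mem_filter.1 hp).1)
    fun p hp => (Finset.mem_filter.1 hp).2
  have e1 : s / L * (Real.exp 1 * (2 * K) * (L / T)) = s * (Real.exp 1 * (2 * K)) / T := by
    field_simp
  rw [e1] at b1
  have b0 := sum_localSum_window_le hg hP hK hU (S := S₂) (Y := L / T) (Z := L * T)
    (by positivity) (by linarith) (fun p hp => hS p (Finset.mem_filter.1 hp).1)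
    fun p hp => (Finset.mem_filter.1 hp).2
  have e0 : Real.exp 1 * (2 * K) * (L * T) / (L / T) = Real.exp 1 * (2 * K) * T ^ 2 := by
    field_simp
  rw [e0, ← hB] at b0
  have b2 := sum_norm_localRatio_sub_one_window_le hg hh hP hd (σ := s / L) (Y := L / T) hσ.le
    (fun p hp => hS p (Finset.mem_filter.1 hp).1) (fun p hp => (Finset.mem_filter.1 hp).2.1) b0
  have b2' := sum_norm_localRatio_sub_one_window_le hg hh hP hd (σ := 0) (Y := L / T) le_rfl
    (fun p hp => hS p (Finset.mem_filter.1 hp).1) (fun p hp => (Finset.mem_filter.1 hp).2.1) b0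
  have b3 := sum_localSum_tail_le hg hP hK hU (S := S₃) (Y := L * T) hσ hσ1 (by positivity)
    (fun p hp => hS p (Finset.mem_filter.1 hp).1) fun p hp => (Finset.mem_filter.1 hp).2
  have e3 : 2 * K / (s / L) / (L * T) = 2 * K / s / T := by field_simp
  rw [e3] at b3
  have split : ∑ p ∈ S, ‖localRatio h g (s / L) p -
        if Real.log p ≤ L then localRatio h g 0 p else 1‖ ≤
      ∑ p ∈ S₁, ‖localRatio h g (s / L) p - localRatio h g 0 p‖ +
      (∑ p ∈ S₂, ‖localRatio h g (s / L) p - 1‖ + ∑ p ∈ S₂, ‖localRatio h g 0 p - 1‖) +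
      2 * ∑ p ∈ S₃, localSum g (s / L) p := by
    rw [hS₁, hS₂, hS₃, Finset.sum_filter, Finset.sum_filter, Finset.sum_filter,
      Finset.sum_filter, Finset.mul_sum, ← Finset.sum_add_distrib, ← Finset.sum_add_distrib,
      ← Finset.sum_add_distrib]
    refine Finset.sum_le_sum fun p hp => ?_
    by_cases c1 : Real.log p ≤ L / T
    · have c2 : ¬ (L / T < Real.log p ∧ Real.log p ≤ L * T) := fun h => by linarith [h.1]
      have c3 : ¬ (L * T < Real.log p) := by linarith
      rw [if_pos (c1.trans hLT'), if_pos c1, if_neg c2, if_neg c2, if_neg c3]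
      linarith
    · by_cases c3 : L * T < Real.log p
      · have c2 : ¬ (L / T < Real.log p ∧ Real.log p ≤ L * T) := fun h => by linarith [h.2]
        rw [if_neg (by linarith), if_neg c1, if_neg c2, if_neg c2, if_pos c3]
        have := norm_localRatio_sub_one_le hg hh (hS p hp) (hsum p hp) hσ.le
        linarith
      · have c2 : L / T < Real.log p ∧ Real.log p ≤ L * T := ⟨not_le.1 c1, not_lt.1 c3⟩
        rw [if_neg c1, if_pos c2, if_pos c2, if_neg c3]
        split_ifs
        · have := norm_sub_le_norm_sub_add_norm_sub (localRatio h g (s / L) p) 1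
            (localRatio h g 0 p)
          rw [norm_sub_rev 1] at this
          linarith
        · have := norm_nonneg (localRatio h g 0 p - 1)
          linarith
  linarith

/-- Without summability of the defects only the primes with `log p ≤ L / T` matter, since their
product is already small. -/
lemma norm_prod_localRatio_sub_le (hg : ∀ n, 0 ≤ g n) (hh : ∀ n, ‖h n‖ ≤ g n)
    (hP : Summable (higherPower g 0)) (hK : 1 ≤ K)
    (hU : ∀ N : ℕ, ∑ q ∈ Finset.Icc 1 N, primePowerLog g q ≤ K * N)
    {s L T : ℝ} (hs : 0 < s) (hT : 1 ≤ T)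
    (hTL : T ≤ L) {S : Finset ℕ} (hS : ∀ p ∈ S, p.Prime) :
    ‖∏ p ∈ S, localRatio h g (s / L) p -
        ∏ p ∈ S.filter (fun p : ℕ => Real.log p ≤ L), localRatio h g 0 p‖ ≤
      2 * (s * (Real.exp 1 * (2 * K)) / T +
        ∑' x, (higherPower g 0 x - higherPower g (s / L) x)) +
      ‖∏ p ∈ S.filter (fun p : ℕ => Real.log p ≤ L / T), localRatio h g 0 p‖ +
      ‖∏ p ∈ S.filter (fun p : ℕ => Real.log p ≤ L), localRatio h g 0 p‖ := by
  have hT0 : 0 < T := by linarith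
  have hL : 0 < L := by linarith
  have hσ : 0 < s / L := by positivity
  have hle : ∀ (σ : ℝ), 0 ≤ σ → ∀ p ∈ S, ‖localRatio h g σ p‖ ≤ 1 := fun σ hσ p hp =>
    norm_localRatio_le_one hg hh (hS p hp) (summable_localSum_of_higherPower hP (hS p hp)) hσ
  set S₁ := S.filter (fun p : ℕ => Real.log p ≤ L / T) with hS₁
  have b1 := sum_norm_localRatio_sub_le hg hh hP hK hU (S := S₁) (σ := s / L) (Y := L / T) hσ.le
    (by rw [le_div_iff₀ hT0]; linarith) (fun p hp => hS p (Finset.mem_filter.1 hp).1)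
    fun p hp => (Finset.mem_filter.1 hp).2
  have e1 : s / L * (Real.exp 1 * (2 * K) * (L / T)) = s * (Real.exp 1 * (2 * K)) / T := by
    field_simp
  rw [e1] at b1
  have b2 := norm_prod_sub_prod_le S₁
    (fun p hp => hle (s / L) hσ.le p (Finset.mem_filter.1 hp).1)
    fun p hp => hle 0 le_rfl p (Finset.mem_filter.1 hp).1
  have b3 : ‖∏ p ∈ S, localRatio h g (s / L) p‖ ≤ ‖∏ p ∈ S₁, localRatio h g (s / L) p‖ := by
    rw [← Finset.prod_filter_mul_prod_filter_not S (fun p : ℕ => Real.log p ≤ L / T), norm_mul]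
    refine mul_le_of_le_one_right (norm_nonneg _) ?_
    rw [norm_prod]
    exact Finset.prod_le_one (fun p _ => norm_nonneg _)
      fun p hp => hle _ hσ.le p (Finset.mem_filter.1 hp).1
  have b4 := norm_sub_le (∏ p ∈ S, localRatio h g (s / L) p)
    (∏ p ∈ S.filter (fun p : ℕ => Real.log p ≤ L), localRatio h g 0 p)
  have b5 := norm_le_norm_sub_add (∏ p ∈ S₁, localRatio h g (s / L) p)
    (∏ p ∈ S₁, localRatio h g 0 p)
  linarith

lemma eventually_norm_prod_localRatio_sub_le (hg : ∀ n, 0 ≤ g n) (hh : ∀ n, ‖h n‖ ≤ g n)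
    (hP : Summable (higherPower g 0)) (hK : 1 ≤ K)
    (hU : ∀ N : ℕ, ∑ q ∈ Finset.Icc 1 N, primePowerLog g q ≤ K * N)
    {s ε : ℝ} (hs : 0 < s) (hε : 0 < ε) :
    ∀ᶠ L : ℝ in atTop, ∀ᶠ N : ℕ in atTop,
      ‖∏ p ∈ Nat.primesBelow N, localRatio h g (s / L) p -
        ∏ p ∈ primesLogLE L, localRatio h g 0 p‖ ≤ ε := by
  have hprime : ∀ N : ℕ, ∀ p ∈ Nat.primesBelow N, p.Prime := fun N p hp =>
    Nat.prime_of_mem_primesBelow hp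
  obtain ⟨T, hT1, hT⟩ : ∃ T : ℝ, 1 ≤ T ∧
      2 * (s * (Real.exp 1 * (2 * K)) / T) + 2 * (2 * K / s / T) < ε := by
    have h1 : Tendsto (fun T : ℝ => 2 * (s * (Real.exp 1 * (2 * K)) / T) + 2 * (2 * K / s / T))
        atTop (𝓝 (2 * 0 + 2 * 0)) :=
      ((tendsto_const_nhds.div_atTop tendsto_id).const_mul 2).add
        ((tendsto_const_nhds.div_atTop tendsto_id).const_mul 2)
    exact ((eventually_ge_atTop 1).and (h1.eventually_lt_const (by linarith))).exists
  have hT0 : 0 < T := by linarith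
  have tσ : Tendsto (fun L : ℝ => s / L) atTop (𝓝[>] 0) :=
    tendsto_nhdsWithin_iff.2 ⟨tendsto_const_nhds.div_atTop tendsto_id, by
      filter_upwards [eventually_gt_atTop 0] with L hL
      exact div_pos hs hL⟩
  have tV := (tendsto_tsum_higherPower_sub hg hP).comp tσ
  have tdiv : Tendsto (fun L : ℝ => L / T) atTop atTop := tendsto_id.atTop_div_const hT0
  have tmul : Tendsto (fun L : ℝ => L * T) atTop atTop := tendsto_id.atTop_mul_const hT0
  by_cases hd : Summable (ratioDefect h g)
  · obtain ⟨B, hB⟩ : ∃ B, B = Real.exp 1 * (2 * K) * T ^ 2 + ∑' x, higherPower g 0 x := ⟨_, rfl⟩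
    have tD := (tendsto_tsum_ratioDefect_tail hg hh hP hd).comp tdiv
    have tS := (Real.continuous_sqrt.tendsto _).comp (tD.const_mul (B * (1 + B) ^ 2))
    rw [mul_zero, Real.sqrt_zero] at tS
    have tH := (tendsto_tsum_higherPower_tail hg hP).comp tmul
    have tE := ((((tendsto_const_nhds (x := s * (Real.exp 1 * (2 * K)) / T)).add tV).const_mul
      2).add (tS.const_mul 2)).add
      (((tendsto_const_nhds (x := 2 * K / s / T)).add tH).const_mul 2)
    filter_upwards [tE.eventually_lt_const (u := ε) (by linarith), eventually_ge_atTop s,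
      eventually_ge_atTop T] with L hE hsL hTL
    filter_upwards [eventually_filter_primesBelow L] with N hN
    have := norm_prod_localRatio_sub_le_of_summable hg hh hP hK hU hd hs hsL hT1 hTL
      (hprime N) hB
    rw [hN] at this
    exact this.trans hE.le
  · have tM := tendsto_prod_localRatio_of_not_summable hg hh hP hd
    have tE := ((((tendsto_const_nhds (x := s * (Real.exp 1 * (2 * K)) / T)).add tV).const_mul
      2).add (tM.comp tdiv)).add tM
    have hpos : 0 ≤ 2 * (2 * K / s / T) := by positivity
    filter_upwards [tE.eventually_lt_const (u := ε) (by linarith), eventually_ge_atTop T]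
      with L hE hTL
    filter_upwards [eventually_filter_primesBelow L, eventually_filter_primesBelow (L / T)]
      with N hN hN'
    have := norm_prod_localRatio_sub_le hg hh hP hK hU hs hT1 hTL (hprime N)
    rw [hN, hN'] at this
    exact this.trans hE.le

end

/-! ### Comparison of the two Dirichlet series -/

section

variable {g : ArithmeticFunction ℝ} {h : ArithmeticFunction ℂ} {K : ℝ}

lemma tendsto_prod_one_add_localSum {𝕜 : Type*} [NormedField 𝕜] [CompleteSpace 𝕜]
    [NormedAlgebra ℝ 𝕜] {f : ArithmeticFunction 𝕜} (hf : f.IsMultiplicative) {σ : ℝ}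
    (hs : Summable fun n => ‖dirichletWeight σ n • f n‖)
    (hp : ∀ p : ℕ, p.Prime →
      Summable fun k : ℕ => dirichletWeight σ (p ^ (k + 1)) • f (p ^ (k + 1))) :
    Tendsto (fun N : ℕ => ∏ p ∈ Nat.primesBelow N, (1 + localSum f σ p)) atTop
      (𝓝 (∑' n, dirichletWeight σ n • f n)) := by
  have h1 := EulerProduct.eulerProduct (f := fun n => dirichletWeight σ n • f n)
    (by simp [dirichletWeight_one, hf.map_one])
    (fun {m n} hmn => by
      simp only [hf.map_mul_of_coprime hmn, dirichletWeight_mul, smul_mul_smul_comm])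
    hs (by simp)
  refine h1.congr fun N => Finset.prod_congr rfl fun p hpN => ?_
  have h2 : Summable fun k : ℕ => dirichletWeight σ (p ^ k) • f (p ^ k) :=
    (summable_nat_add_iff 1).1 (hp p (Nat.prime_of_mem_primesBelow hpN))
  rw [h2.tsum_eq_zero_add, pow_zero, dirichletWeight_one, hf.map_one, one_smul, localSum]

/-- A bound on the products of local ratios passes to the Dirichlet series. -/
lemma norm_tsum_sub_mul_le (hg : g.IsMultiplicative) (h0 : ∀ n, 0 ≤ g n)
    (hh : h.IsMultiplicative) (hhg : ∀ n, ‖h n‖ ≤ g n) (hP : Summable (higherPower g 0))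
    {σ ε : ℝ} (hσ : 0 ≤ σ) (hs : Summable fun n => g n * dirichletWeight σ n) {P : ℂ}
    (hN : ∀ᶠ N : ℕ in atTop,
      ‖∏ p ∈ Nat.primesBelow N, localRatio h g σ p - P‖ ≤ ε) :
    ‖∑' n, (h n - P * g n) * (dirichletWeight σ n : ℂ)‖ ≤ ε * dirichletSum g σ := by
  have hs1 : Summable fun n => dirichletWeight σ n • g n :=
    hs.congr fun n => by rw [smul_eq_mul, mul_comm]
  have hs2 : Summable fun n => ‖dirichletWeight σ n • h n‖ :=
    Summable.of_nonneg_of_le (fun _ => norm_nonneg _)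
      (fun n => norm_dirichletWeight_smul_le hhg n) hs1
  have tg := tendsto_prod_one_add_localSum hg hs1.norm fun p hp =>
    summable_localSum h0 hp (summable_localSum_of_higherPower hP hp) hσ
  have th := tendsto_prod_one_add_localSum hh hs2 fun p hp =>
    summable_localSum_complex h0 hhg hp (summable_localSum_of_higherPower hP hp) hσ
  have eg : ∑' n, dirichletWeight σ n • g n = dirichletSum g σ :=
    tsum_congr fun n => by rw [smul_eq_mul, mul_comm]
  rw [eg] at tg
  have e : ∑' n, (h n - P * g n) * (dirichletWeight σ n : ℂ) =
      ∑' n, dirichletWeight σ n • h n - P * (dirichletSum g σ : ℂ) := by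
    rw [← eg, Complex.ofReal_tsum, ← tsum_mul_left,
      ← hs2.of_norm.tsum_sub ((Complex.hasSum_ofReal.2 hs1.hasSum).summable.mul_left P)]
    refine tsum_congr fun n => ?_
    rw [Complex.real_smul, smul_eq_mul]
    push_cast
    ring
  rw [e]
  have tg' := (Complex.continuous_ofReal.tendsto _).comp tg
  refine le_of_tendsto_of_tendsto (th.sub (tg'.const_mul P)).norm (tg.const_mul ε) ?_
  filter_upwards [hN] with N hN
  have hpos : 0 ≤ ∏ p ∈ Nat.primesBelow N, (1 + localSum g σ p) :=
    Finset.prod_nonneg fun p _ => by linarith [localSum_nonneg h0 (σ := σ) (p := p)]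
  have e2 : ∏ p ∈ Nat.primesBelow N, (1 + localSum h σ p) =
      (∏ p ∈ Nat.primesBelow N, localRatio h g σ p) *
        ((∏ p ∈ Nat.primesBelow N, (1 + localSum g σ p) : ℝ) : ℂ) := by
    rw [Complex.ofReal_prod, ← Finset.prod_mul_distrib]
    refine Finset.prod_congr rfl fun p _ => ?_
    rw [localRatio, div_mul_cancel₀]
    exact Complex.ofReal_ne_zero.2 (by linarith [localSum_nonneg h0 (σ := σ) (p := p)])
  rw [Function.comp, e2, ← sub_mul, norm_mul, Complex.norm_real, Real.norm_of_nonneg hpos]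
  exact mul_le_mul_of_nonneg_right hN hpos

lemma dirichletSum_anti (h0 : ∀ n, 0 ≤ g n) {σ τ : ℝ} (hστ : σ ≤ τ)
    (hs : Summable fun n => g n * dirichletWeight σ n) :
    dirichletSum g τ ≤ dirichletSum g σ := by
  have hle : ∀ n, g n * dirichletWeight τ n ≤ g n * dirichletWeight σ n := fun n => by
    rcases Nat.eq_zero_or_pos n with rfl | hn
    · simp
    · exact mul_le_mul_of_nonneg_left (dirichletWeight_anti hστ hn) (h0 n)
  exact (Summable.of_nonneg_of_le (mul_dirichletWeight_nonneg h0 τ) hle hs).tsum_le_tsum hle hs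

/-! ### The logarithmic sums -/

lemma eventually_norm_logSum_sub_le (hg : g.IsMultiplicative) (h0 : ∀ n, 0 ≤ g n)
    (hh : h.IsMultiplicative) (hhg : ∀ n, ‖h n‖ ≤ g n) (hP : Summable (higherPower g 0))
    (hK : 1 ≤ K) (hU : ∀ N : ℕ, ∑ q ∈ Finset.Icc 1 N, primePowerLog g q ≤ K * N)
    {δ : ℝ} (hδ : 0 < δ) :
    ∀ᶠ L : ℝ in atTop, ‖logSum h (Real.exp L) -
      (∏ p ∈ primesLogLE L, localRatio h g 0 p) * ((logSum g (Real.exp L) : ℝ) : ℂ)‖ ≤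
        δ * dirichletSum g (1 / L) := by
  have hM : 0 < K * Real.exp 2 := by positivity
  have hη : 0 < min 1 (δ / (8 * (K * Real.exp 2))) := lt_min one_pos (by positivity)
  obtain ⟨η, hη0, hη1, hη2⟩ : ∃ η : ℝ, 0 < η ∧ η ≤ 1 ∧ η ≤ δ / (8 * (K * Real.exp 2)) :=
    ⟨_, hη, min_le_left _ _, min_le_right _ _⟩
  obtain ⟨Q, hQ⟩ := exists_polynomial_approx_indicator (ε := δ / 8) (by positivity) hη0
  set A := ∑ k ∈ Finset.range (Q.natDegree + 1), |Q.coeff k| with hA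
  have hA0 : 0 ≤ A := Finset.sum_nonneg fun _ _ => abs_nonneg _
  have hε1 : 0 < δ / (4 * (A + 1)) := by positivity
  have hall : ∀ᶠ L : ℝ in atTop, ∀ k ∈ Finset.range (Q.natDegree + 1), ∀ᶠ N : ℕ in atTop,
      ‖∏ p ∈ Nat.primesBelow N, localRatio h g ((k + 1) / L) p -
        ∏ p ∈ primesLogLE L, localRatio h g 0 p‖ ≤ δ / (4 * (A + 1)) :=
    (Finset.eventually_all _).2 fun k _ =>
      eventually_norm_prod_localRatio_sub_le h0 hhg hP hK hU (by positivity) hε1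
  filter_upwards [hall, eventually_ge_atTop ((Q.natDegree : ℝ) + 1),
    eventually_ge_atTop (16 * (K * Real.exp 2) / δ)] with L hL hL1 hL2
  have hL1' : 1 ≤ L := by
    have : (0 : ℝ) ≤ Q.natDegree := Nat.cast_nonneg _
    linarith
  have hL0 : 0 < L := by linarith
  set P := ∏ p ∈ primesLogLE L, localRatio h g 0 p with hPdef
  have hPle : ‖P‖ ≤ 1 := by
    rw [hPdef, norm_prod]
    exact Finset.prod_le_one (fun _ _ => norm_nonneg _) fun p hp =>
      norm_localRatio_le_one h0 hhg (mem_primesLogLE.1 hp).1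
        (summable_localSum_of_higherPower hP (mem_primesLogLE.1 hp).1) le_rfl
  have hs1 : Summable fun n => g n * dirichletWeight (1 / L) n :=
    summable_mul_dirichletWeight hg h0 hK hU (by positivity) (by rw [div_le_one hL0]; exact hL1')
  have hG0 : 0 ≤ dirichletSum g (1 / L) := tsum_nonneg (mul_dirichletWeight_nonneg h0 _)
  have hc : ∀ n, ‖h n - P * g n‖ ≤ 2 * g n := fun n => by
    have h2 : ‖P * (g n : ℂ)‖ ≤ g n := by
      rw [norm_mul, Complex.norm_real, Real.norm_of_nonneg (h0 n)]
      exact mul_le_of_le_one_left (h0 n) hPle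
    linarith [norm_sub_le (h n) (P * (g n : ℂ)), hhg n]
  have main := norm_sum_div_le_of_polynomial (c := fun n => h n - P * g n) h0 g.map_zero hc hL0
    hQ hs1
  have e : ∑ n ∈ Finset.Icc 1 ⌊Real.exp L⌋₊, (h n - P * g n) / n =
      logSum h (Real.exp L) - P * ((logSum g (Real.exp L) : ℝ) : ℂ) := by
    rw [logSum, logSum, Complex.ofReal_sum, Finset.mul_sum, ← Finset.sum_sub_distrib]
    refine Finset.sum_congr rfl fun n _ => ?_
    push_cast
    ring
  rw [e] at main
  have b1 : ∑ k ∈ Finset.range (Q.natDegree + 1), |Q.coeff k| *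
      ‖∑' n, (h n - P * g n) * (dirichletWeight ((k + 1) / L) n : ℂ)‖ ≤
      A * (δ / (4 * (A + 1)) * dirichletSum g (1 / L)) := by
    rw [hA, Finset.sum_mul]
    refine Finset.sum_le_sum fun k hk => mul_le_mul_of_nonneg_left ?_ (abs_nonneg _)
    have hk1 : (k : ℝ) + 1 ≤ L := by
      have : (k : ℝ) ≤ Q.natDegree := by
        exact_mod_cast Nat.lt_succ_iff.1 (Finset.mem_range.1 hk)
      linarith
    have hk0 : 0 < ((k : ℝ) + 1) / L := by positivity
    have hsk := summable_mul_dirichletWeight hg h0 hK hU hk0 (by rw [div_le_one hL0]; exact hk1)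
    refine (norm_tsum_sub_mul_le hg h0 hh hhg hP hk0.le hsk (hL k hk)).trans ?_
    refine mul_le_mul_of_nonneg_left (dirichletSum_anti h0 ?_ hs1) hε1.le
    exact div_le_div_of_nonneg_right (by linarith [(Nat.cast_nonneg k : (0 : ℝ) ≤ k)]) hL0.le
  have b1' : A * (δ / (4 * (A + 1)) * dirichletSum g (1 / L)) ≤
      δ / 4 * dirichletSum g (1 / L) := by
    rw [← mul_assoc]
    refine mul_le_mul_of_nonneg_right ?_ hG0
    rw [mul_div_assoc', div_le_div_iff₀ (by positivity) (by norm_num)]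
    nlinarith
  have b2 := sum_window_le_dirichletSum hg h0 hK hU hL1' hη0 hη1
  have b3 : K * (2 / L + η) * Real.exp 2 ≤ δ / 4 := by
    have h1 : 2 / L * (K * Real.exp 2) ≤ δ / 8 := by
      rw [div_le_iff₀ hδ] at hL2
      rw [div_mul_eq_mul_div, div_le_iff₀ hL0]
      linarith
    have h2 : η * (K * Real.exp 2) ≤ δ / 8 := by
      rw [le_div_iff₀ (by positivity)] at hη2
      linarith
    linarith
  have b4 := mul_le_mul_of_nonneg_right b3 hG0
  linarith

end

lemma one_add_localSum_eq_eulerFactor {𝕜 : Type*} [RCLike 𝕜] (f : ArithmeticFunction 𝕜) (p : ℕ) :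
    1 + localSum f 0 p = eulerFactor f p := by
  rw [localSum, eulerFactor]
  congr 1
  refine tsum_congr fun k => ?_
  rw [dirichletWeight_zero, RCLike.real_smul_eq_coe_mul]
  push_cast
  ring

theorem theorem1
    (g : ArithmeticFunction ℝ) (hg : g.IsMultiplicative) (hg_nonneg : ∀ n : ℕ, 0 ≤ g n)
    (hg_primes : ∃ β : ℝ, ∀ p : ℕ, p.Prime → g p ≤ β)
    (hg_powers : Summable fun q : {q : ℕ // IsPrimePow q ∧ ¬ q.Prime} => g q / ((q : ℕ) : ℝ))
    (hg_sums : ∃ K : ℝ, ∀ y : ℝ, 2 ≤ y →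
      y⁻¹ * ∑ q ∈ (Finset.Icc 1 ⌊y⌋₊).filter IsPrimePow, g q * Real.log q ≤ K)
    (h : ArithmeticFunction ℂ) (hh : h.IsMultiplicative) (hhg : ∀ n : ℕ, ‖h n‖ ≤ g n) :
    (∀ p : ℕ, p.Prime → Summable fun k : ℕ => g (p ^ (k + 1)) / (p : ℝ) ^ (k + 1)) ∧
    (∀ p : ℕ, p.Prime → Summable fun k : ℕ => h (p ^ (k + 1)) / (p : ℂ) ^ (k + 1)) ∧
    ∃ ε : ℝ → ℂ, Tendsto ε atTop (𝓝 0) ∧ ∀ x : ℝ, 1 ≤ x →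
      logSum h x =
        ((∏ p ∈ (Finset.Icc 1 ⌊x⌋₊).filter Nat.Prime,
            eulerFactor h p * ((eulerFactor g p : ℝ) : ℂ)⁻¹) + ε x) * ((logSum g x : ℝ) : ℂ) := by
  have hP := summable_higherPower hg_powers
  obtain ⟨K, hK, hU⟩ := exists_sum_primePowerLog_le hg_sums
  have hsum := fun (p : ℕ) (hp : p.Prime) => summable_localSum_of_higherPower hP hp
  refine ⟨fun p hp => (hsum p hp).congr fun k => ?_, fun p hp =>
    (summable_localSum_complex hg_nonneg hhg hp (hsum p hp) le_rfl).congr fun k => ?_, ?_⟩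
  · rw [dirichletWeight_zero, smul_eq_mul]
    push_cast
    ring
  · rw [dirichletWeight_zero, Complex.real_smul]
    push_cast
    ring
  have hG1 : ∀ x : ℝ, 1 ≤ x → 1 ≤ logSum g x := fun x hx => by
    have h1 := Finset.single_le_sum (f := fun n : ℕ => g n / (n : ℝ)) (s := Finset.Icc 1 ⌊x⌋₊)
      (fun n _ => div_nonneg (hg_nonneg n) (Nat.cast_nonneg n))
      (Finset.mem_Icc.2 ⟨le_rfl, Nat.le_floor (by simpa using hx)⟩ : 1 ∈ Finset.Icc 1 ⌊x⌋₊)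
    simpa [logSum, hg.map_one] using h1
  refine ⟨fun x => logSum h x / ((logSum g x : ℝ) : ℂ) -
    ∏ p ∈ (Finset.Icc 1 ⌊x⌋₊).filter Nat.Prime,
      eulerFactor h p * ((eulerFactor g p : ℝ) : ℂ)⁻¹, ?_, fun x hx => ?_⟩
  · obtain ⟨D, hD0, hD⟩ := exists_dirichletSum_le_mul_logSum hg hg_nonneg hK hU
    rw [NormedAddGroup.tendsto_nhds_zero]
    intro ε hε
    have hmain := Real.tendsto_log_atTop.eventually (eventually_norm_logSum_sub_le hg hg_nonneg hh
      hhg hP hK hU (δ := ε / (2 * D)) (by positivity))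
    filter_upwards [hmain, hD, eventually_ge_atTop 1] with x h1 h2 hx
    have hx0 : 0 < x := by linarith
    have hGx : 0 < logSum g x := zero_lt_one.trans_le (hG1 x hx)
    have eP : ∏ p ∈ primesLogLE (Real.log x), localRatio h g 0 p =
        ∏ p ∈ (Finset.Icc 1 ⌊x⌋₊).filter Nat.Prime,
          eulerFactor h p * ((eulerFactor g p : ℝ) : ℂ)⁻¹ := by
      rw [primesLogLE, Real.exp_log hx0]
      refine Finset.prod_congr rfl fun p _ => ?_
      rw [localRatio, one_add_localSum_eq_eulerFactor, one_add_localSum_eq_eulerFactor,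
        div_eq_mul_inv]
    rw [Real.exp_log hx0, eP] at h1
    have hGne : ((logSum g x : ℝ) : ℂ) ≠ 0 := Complex.ofReal_ne_zero.2 hGx.ne'
    rw [div_sub' hGne, norm_div, Complex.norm_real, Real.norm_of_nonneg hGx.le,
      div_lt_iff₀ hGx, mul_comm ((logSum g x : ℝ) : ℂ)]
    have h3 := mul_le_mul_of_nonneg_left h2 (show 0 ≤ ε / (2 * D) by positivity)
    have e3 : ε / (2 * D) * (D * logSum g x) = ε / 2 * logSum g x := by field_simp
    have h4 : 0 < ε / 2 * logSum g x := by positivity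
    linarith
  · have hGne : ((logSum g x : ℝ) : ℂ) ≠ 0 :=
      Complex.ofReal_ne_zero.2 (zero_lt_one.trans_le (hG1 x hx)).ne'
    rw [add_sub_cancel, div_mul_cancel₀ _ hGne]
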